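/- Let $\lambda,K,T>0$, and let $f$ be a probability density on $(0,\infty)$ with $f(p)>0$ for all $p>0$ and $\lim_{p\to+\infty}p^3f(p)=0$. For $b\in[0,+\infty]$ put $F(b)=\int_0^b f(p)\,dp$ and $G(b)=\int_0^b p f(p)\,dp$. For $0\le t\le T$ and $S\in\mathbb R$ consider the deterministic control problem $$\tilde v(t,S)=\inf_{b}\Big\{-\lambda\int_t^T F(b_s)\,ds+K\min\big(S^{b,t,S}_T,0\big)^2\Big\},\qquad dS^{b,t,S}_s=-\lambda G(b_s)\,ds,\quad S^{b,t,S}_t=S,$$ where the infimum is over all measurable functions $b$ with values in $[0,+\infty]$. Then: 1. $\int_0^\infty pf(p)\,dp<\infty$, and the function $H(x)=\lambda\sup_{b\ge0}\int_0^b f(p)(1+xp)\,dp$ is finite and differentiable on $\mathbb R$, with $H(x)=-\lambda x\int_0^{-1/x}F(p)\,dp$ for $x<0$ and $H(x)=\lambda\big(1+x\int_0^\infty pf(p)\,dp\big)$ for $x\ge0$. 2. For all $(t,S)\in[0,T]\times\mathbb R$, $$\tilde v(t,S)=\sup_{x\le0}\Big(Sx-(T-t)H(x)-\frac{x^2}{4K}\Big).$$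 3. $\tilde v$ is the unique weak semi-concave solution on $[0,T]\times\mathbb R$ of the Hamilton–Jacobi equation $$-\partial_t v(t,S)-\lambda\inf_{b\ge0}\Big(-\int_0^b f(p)\big(1+p\,\partial_S v(t,S)\big)dp\Big)=0,\qquad v(T,S)=K\min(S,0)^2,$$ that is, the unique function $v$ that is locally Lipschitz on $[0,T]\times\mathbb R$, satisfies the terminal condition, satisfies the equation almost everywhere in $(0,T)\times\mathbb R$, and for which there is $C\ge0$ with $v(t,S+z)-2v(t,S)+v(t,S-z)\le C\big(1+\frac1{T-t}\big)z^2$ for all $t\in[0,T)$ and $S,z\in\mathbb R$. 4. The optimal control function $\tilde b^*:[0,T]\times\mathbb R\to[0,+\infty]$ is given as follows. If $S\ge\lambda(T-t)\int_0^\infty pf(p)\,dp$, then $\tilde b^*(t,S)=+\infty$. If $S<\lambda(T-t)\int_0^\infty pf(p)\,dp$, then $\tilde b^*(t,S)=-1/x^*$, where $x^*$ is the unique real solution of $$S=(T-t)H'(x^*)+\frac{x^*}{2K},$$ and $x^*<0$. This means that from every initial condition $(t,S)$ there is an optimal control, and that a measurable control $b$ is optimal if and only if $b_s=\tilde b^*(s,S^{b,t,S}_s)$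 for almost every $s\in[t,T]$. -/

import Mathlib

open MeasureTheory Filter Topology Set
open scoped NNReal ENNReal

/-- `f` is the probability density of the price to beat, which is almost surely positive:
only the restriction of `f` to `(0, ∞)` matters. -/
structure IsPriceDensity (f : ℝ → ℝ) : Prop where
  integrableOn : IntegrableOn f (Ioi 0)
  integral_eq_one : ∫ p in Ioi (0 : ℝ), f p = 1
  pos : ∀ p : ℝ, 0 < p → 0 < f p
  tail : Tendsto (fun p : ℝ => p ^ 3 * f p) atTop (𝓝 0)

/-- `F(b)`, the cumulative distribution function of the price to beat at `b ∈ [0, +∞]`. -/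
noncomputable def priceCDF (f : ℝ → ℝ) (b : ℝ≥0∞) : ℝ :=
  ∫ p in {p : ℝ | 0 < p ∧ ENNReal.ofReal p ≤ b}, f p

/-- `G(b) = ∫_0^b p f(p) dp` for `b ∈ [0, +∞]`. -/
noncomputable def expectedPayment (f : ℝ → ℝ) (b : ℝ≥0∞) : ℝ :=
  ∫ p in {p : ℝ | 0 < p ∧ ENNReal.ofReal p ≤ b}, p * f p

/-- The mean price to beat `∫_0^∞ p f(p) dp`. -/
noncomputable def meanPrice (f : ℝ → ℝ) : ℝ :=
  ∫ p in Ioi (0 : ℝ), p * f p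

/-- The Hamiltonian `H(x) = lam * sup_{b ≥ 0} ∫_0^b f(p) (1 + x p) dp`. -/
noncomputable def hamiltonian (lam : ℝ) (f : ℝ → ℝ) (x : ℝ) : ℝ :=
  lam * ⨆ b : ℝ≥0, ∫ p in (0 : ℝ)..(b : ℝ), f p * (1 + x * p)

/-- The budget at time `s` under the control `b`, started from `S` at time `t`: the absolutely
continuous solution of `dS_s = - lam * G(b_s) ds`, `S_t = S`. -/
noncomputable def budget (lam : ℝ) (f : ℝ → ℝ) (b : ℝ → ℝ≥0∞) (t S s : ℝ) : ℝ :=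
  S - lam * ∫ r in t..s, expectedPayment f (b r)

/-- The cost of the control `b` over `[t, T]`, started from the budget `S` at time `t`. -/
noncomputable def cost (lam K T : ℝ) (f : ℝ → ℝ) (t S : ℝ) (b : ℝ → ℝ≥0∞) : ℝ :=
  -(lam * ∫ s in t..T, priceCDF f (b s)) + K * (min (budget lam f b t S T) 0) ^ 2

/-- The value function: the infimum of the cost over all measurable deterministic bidding
strategies with values in `[0, +∞]`. -/
noncomputable def valueFn (lam K T : ℝ) (f : ℝ → ℝ) (t S : ℝ) : ℝ :=
  ⨅ b : {b : ℝ → ℝ≥0∞ // Measurable b}, cost lam K T f t S b.1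

/-- `b` is an optimal control for the problem started from the budget `S` at time `t`. -/
def IsOptimalControl (lam K T : ℝ) (f : ℝ → ℝ) (t S : ℝ) (b : ℝ → ℝ≥0∞) : Prop :=
  Measurable b ∧
    ∀ b' : ℝ → ℝ≥0∞, Measurable b' → cost lam K T f t S b ≤ cost lam K T f t S b'

/-- `β` is the optimal control function (in feedback form): from every initial condition there is
an optimal control, and the optimal controls are exactly the controls that bid `β(s, S_s)` at
(almost) every time `s`, where `S_s` is the budget that they themselves generate. -/
def IsOptimalControlFunction (lam K T : ℝ) (f : ℝ → ℝ) (β : ℝ → ℝ → ℝ≥0∞) : Prop :=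
  ∀ t ∈ Icc 0 T, ∀ S : ℝ,
    (∃ b, IsOptimalControl lam K T f t S b) ∧
    ∀ b : ℝ → ℝ≥0∞, Measurable b →
      (IsOptimalControl lam K T f t S b ↔
        ∀ᵐ s ∂(volume.restrict (Icc t T)), b s = β s (budget lam f b t S s))

/-- `v` is a weak semi-concave solution on `[0, T] × ℝ` of the terminal value problem
`-∂_t v - lam * inf_{b ≥ 0} (- ∫_0^b f(p) (1 + p ∂_S v) dp) = 0`, `v(T, S) = K min(S, 0)^2`:
it is locally Lipschitz (the terminal datum is not globally Lipschitz), solves the equation almost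
everywhere, and is semi-concave in `S`, with a constant that may blow up at time `T` like
`1 / (T - t)`. -/
structure IsWeakSemiconcaveSolution (lam K T : ℝ) (f : ℝ → ℝ) (v : ℝ → ℝ → ℝ) : Prop where
  locallyLipschitz : LocallyLipschitzOn (Icc 0 T ×ˢ univ) (fun z : ℝ × ℝ => v z.1 z.2)
  terminal : ∀ S : ℝ, v T S = K * (min S 0) ^ 2
  equation : ∀ᵐ z ∂(volume.restrict (Ioo 0 T ×ˢ univ) : Measure (ℝ × ℝ)), ∃ vt vS : ℝ,
    HasDerivAt (fun r => v r z.2) vt z.1 ∧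
    HasDerivAt (fun y => v z.1 y) vS z.2 ∧
    -vt - lam * (⨅ b : ℝ≥0, -∫ p in (0 : ℝ)..(b : ℝ), f p * (1 + p * vS)) = 0
  semiconcave : ∃ C : ℝ, 0 ≤ C ∧ ∀ t ∈ Ico 0 T, ∀ S z : ℝ,
    v t (S + z) - 2 * v t S + v t (S - z) ≤ C * (1 + 1 / (T - t)) * z ^ 2

/-!
The argument is convex duality for the control problem, followed by a comparison argument for the
Hamilton-Jacobi equation that needs no regularity of `f`.

*The Hamiltonian.* The rate of gain `F(b) + x G(b) = ∫_0^b f(p) (1 + x p) dp` is maximised by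
winning exactly the prices with `1 + x p ≥ 0`, that is by `bidOf x`, and by no other bid, since
`f > 0`. Hence `H` is a supremum of affine functions with the subgradient `spendRate = λ G(bidOf x)`,
and a continuous subgradient is a derivative (`hasDerivAt_of_continuousAt_subgradient`).

*Duality.* For `x ≤ 0`, a control costs at least `S x - (T - t) H(x) - x² / (4 K)`, and the gap is
the sum of a terminal term and of the accumulated loss of the bids compared with `bidOf x`
(`cost_sub_dualObjective`). The gap vanishes at the `costate` `x` with
`S = (T - t) H'(x) + x / (2 K)`, cut off at `0`, exactly for the controls equal to `bidOf x` almost everywhere; this gives the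
value function and the optimal controls. The costate is constant along the optimal trajectory, so
that these controls have the feedback form; conversely, the feedback bid is nondecreasing in the
budget, so that the closed loop equation has only one solution.

*Regularity.* As a function of `(T - t, S)` the value is a supremum of affine functions with a
continuous subgradient, whence it is a `C¹` solution. The quadratic term `x² / (4 K)` makes the
costate Lipschitz in `S`, which gives the semi-concavity.

*Uniqueness.* Let `u` be a weak semi-concave solution. By Rademacher's and Fubini's theorems the
equation can be integrated along the lines followed under constant bids, and since the optimal
controls are constant, `u` is at most the value (`le_dualValue`). For the other inequality,
semi-concavity and the equation almost everywhere imply that `u` is a supersolution in the sense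
of touching functions (`eventually_sub_le`). Comparison with the `C¹` value function then follows
by minimising the penalised difference over a compact set (`dualValue_le`), because
`0 ≤ H' ≤ λ ∫ p f(p) dp` bounds the speed of propagation.
-/

/-! ### Functions with a continuous subgradient -/

/-- A selection of subgradients that is continuous at a point is the derivative there. -/
theorem hasDerivAt_of_continuousAt_subgradient {h g : ℝ → ℝ} {x : ℝ}
    (hsub : ∀ᶠ y in 𝓝 x, h x + g x * (y - x) ≤ h y ∧ h y + g y * (x - y) ≤ h x)
    (hg : ContinuousAt g x) : HasDerivAt h (g x) x := by
  rw [hasDerivAt_iff_isLittleO, Asymptotics.isLittleO_iff]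
  intro c hc
  filter_upwards [hsub, Metric.continuousAt_iff'.1 hg c hc] with y ⟨h1, h2⟩ h3
  rw [Real.dist_eq] at h3
  have h4 : |h y - h x - (y - x) • g x| ≤ |g y - g x| * |y - x| := by
    rw [← abs_mul, smul_eq_mul, abs_of_nonneg (by linarith)]
    exact le_trans (by nlinarith) (le_abs_self _)
  rw [Real.norm_eq_abs, Real.norm_eq_abs]
  exact h4.trans (mul_le_mul_of_nonneg_right h3.le (abs_nonneg _))

theorem hasDerivAt_max_zero_sq (x : ℝ) :
    HasDerivAt (fun y : ℝ => max y 0 ^ 2) (2 * max x 0) x := by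
  refine hasDerivAt_of_continuousAt_subgradient (g := fun y => 2 * max y 0)
    (Eventually.of_forall fun y => ?_) (by fun_prop)
  constructor <;> rcases max_cases x 0 with ⟨h1, h2⟩ | ⟨h1, h2⟩ <;>
    rcases max_cases y 0 with ⟨h3, h4⟩ | ⟨h3, h4⟩ <;> simp only [h1, h3] <;>
    nlinarith [sq_nonneg (x - y)]

/-! ### Integrals over the prices below a bid -/

/-- The prices to beat that the bid `b ∈ [0, ∞]` wins. -/
def pricesBelow (b : ℝ≥0∞) : Set ℝ := {p : ℝ | 0 < p ∧ ENNReal.ofReal p ≤ b}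

theorem measurableSet_pricesBelow (b : ℝ≥0∞) : MeasurableSet (pricesBelow b) :=
  measurableSet_Ioi.inter (measurableSet_le ENNReal.measurable_ofReal measurable_const)

theorem pricesBelow_subset (b : ℝ≥0∞) : pricesBelow b ⊆ Ioi 0 := fun _ hp => hp.1

theorem pricesBelow_mono {b c : ℝ≥0∞} (h : b ≤ c) : pricesBelow b ⊆ pricesBelow c :=
  fun _ hp => ⟨hp.1, hp.2.trans h⟩

theorem pricesBelow_top : pricesBelow ⊤ = Ioi 0 := by
  ext p; simp [pricesBelow]

theorem pricesBelow_ofReal {B : ℝ} (hB : 0 ≤ B) : pricesBelow (ENNReal.ofReal B) = Ioc 0 B := by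
  ext p; simp [pricesBelow, ENNReal.ofReal_le_ofReal_iff hB]

theorem continuous_setIntegral_pricesBelow {g : ℝ → ℝ} (hg : IntegrableOn g (Ioi 0)) :
    Continuous fun b : ℝ≥0∞ => ∫ p in pricesBelow b, g p := by
  have hrw : (fun b : ℝ≥0∞ => ∫ p in pricesBelow b, g p) =
      fun b => ∫ p in Ioi (0 : ℝ), (pricesBelow b).indicator g p := by
    funext b
    rw [setIntegral_indicator (measurableSet_pricesBelow b),
      inter_eq_right.2 (pricesBelow_subset b)]
  rw [hrw, continuous_iff_continuousAt]
  intro b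
  refine continuousAt_of_dominated (bound := fun p => ‖g p‖)
    (Eventually.of_forall fun c => hg.aestronglyMeasurable.indicator (measurableSet_pricesBelow c))
    (Eventually.of_forall fun c => Eventually.of_forall fun p => norm_indicator_le_norm_self _ _)
    hg.norm ?_
  -- The integrand is locally constant in the bid, except at the price equal to the bid.
  have hne : ∀ᵐ p ∂(volume.restrict (Ioi (0 : ℝ))), p ≠ b.toReal :=
    ae_restrict_of_ae (Measure.ae_ne volume b.toReal)
  filter_upwards [hne, ae_restrict_mem measurableSet_Ioi] with p hp hp0
  have hp0' : (0 : ℝ) < p := hp0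
  have hpb : ENNReal.ofReal p ≠ b := by
    rintro rfl
    exact hp (ENNReal.toReal_ofReal hp0'.le).symm
  rcases lt_or_gt_of_ne hpb with h | h
  · refine (continuousAt_const (y := g p)).congr ?_
    filter_upwards [lt_mem_nhds h] with c hc
    rw [indicator_of_mem (show p ∈ pricesBelow c from ⟨hp0', le_of_lt hc⟩)]
  · refine (continuousAt_const (y := (0 : ℝ))).congr ?_
    filter_upwards [gt_mem_nhds h] with c hc
    rw [indicator_of_notMem (fun h' : p ∈ pricesBelow c => absurd h'.2 (not_le.2 hc))]

theorem monotone_setIntegral_pricesBelow {g : ℝ → ℝ} (hg : IntegrableOn g (Ioi 0))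
    (h0 : ∀ p, 0 < p → 0 ≤ g p) : Monotone fun b : ℝ≥0∞ => ∫ p in pricesBelow b, g p := by
  intro b c hbc
  refine setIntegral_mono_set (hg.mono_set (pricesBelow_subset c)) ?_
    (pricesBelow_mono hbc).eventuallyLE
  filter_upwards [ae_restrict_mem (measurableSet_pricesBelow c)] with p hp using h0 p hp.1

namespace IsPriceDensity

variable {f : ℝ → ℝ}

theorem integrableOn_id_mul (hf : IsPriceDensity f) :
    IntegrableOn (fun p : ℝ => p * f p) (Ioi 0) := by
  have hev : ∀ᶠ p : ℝ in atTop, p ^ 3 * f p < 1 := hf.tail.eventually (gt_mem_nhds one_pos)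
  obtain ⟨R, hR⟩ := eventually_atTop.1 hev
  set B := max R 1 with hB
  have hB1 : 1 ≤ B := le_max_right _ _
  rw [← Ioc_union_Ioi_eq_Ioi (show (0 : ℝ) ≤ B by linarith)]
  have hm : AEStronglyMeasurable (fun p : ℝ => p * f p) (volume.restrict (Ioi 0)) :=
    (continuous_id.aestronglyMeasurable).mul hf.integrableOn.aestronglyMeasurable
  refine IntegrableOn.union ?_ ?_
  · refine Integrable.mono' ((hf.integrableOn.mono_set Ioc_subset_Ioi_self).const_mul B)
      (hm.mono_measure (Measure.restrict_mono Ioc_subset_Ioi_self le_rfl)) ?_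
    filter_upwards [ae_restrict_mem measurableSet_Ioc] with p hp
    rw [Real.norm_eq_abs, abs_of_pos (mul_pos hp.1 (hf.pos p hp.1))]
    exact mul_le_mul_of_nonneg_right hp.2 (hf.pos p hp.1).le
  · refine Integrable.mono' (integrableOn_Ioi_rpow_of_lt (show (-2 : ℝ) < -1 by norm_num)
      (show (0 : ℝ) < B by linarith)) (hm.mono_measure (Measure.restrict_mono
        (Ioi_subset_Ioi (by linarith)) le_rfl)) ?_
    filter_upwards [ae_restrict_mem measurableSet_Ioi] with p hp
    have hp' : B < p := hp
    have hp0 : 0 < p := by linarith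
    rw [Real.norm_eq_abs, abs_of_pos (mul_pos hp0 (hf.pos p hp0)), Real.rpow_neg hp0.le]
    have h1 := hR p ((le_max_left _ _).trans hp'.le)
    rw [Real.rpow_two, ← one_div, le_div_iff₀ (by positivity)]
    nlinarith

theorem continuous_priceCDF (hf : IsPriceDensity f) : Continuous (priceCDF f) :=
  continuous_setIntegral_pricesBelow hf.integrableOn

theorem continuous_expectedPayment (hf : IsPriceDensity f) : Continuous (expectedPayment f) :=
  continuous_setIntegral_pricesBelow hf.integrableOn_id_mul

theorem monotone_expectedPayment (hf : IsPriceDensity f) : Monotone (expectedPayment f) :=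
  monotone_setIntegral_pricesBelow hf.integrableOn_id_mul
    fun p hp => (mul_pos hp (hf.pos p hp)).le

theorem expectedPayment_nonneg (hf : IsPriceDensity f) (b : ℝ≥0∞) : 0 ≤ expectedPayment f b :=
  setIntegral_nonneg (measurableSet_pricesBelow b) fun p hp => (mul_pos hp.1 (hf.pos p hp.1)).le

end IsPriceDensity

theorem expectedPayment_top (f : ℝ → ℝ) : expectedPayment f ⊤ = meanPrice f := by
  have h : expectedPayment f ⊤ = ∫ p in pricesBelow ⊤, p * f p := rfl
  rw [h, pricesBelow_top]; rfl

theorem IsPriceDensity.priceCDF_top {f : ℝ → ℝ} (hf : IsPriceDensity f) : priceCDF f ⊤ = 1 := by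
  have h : priceCDF f ⊤ = ∫ p in pricesBelow ⊤, f p := rfl
  rw [h, pricesBelow_top, hf.integral_eq_one]

/-! ### The optimal bid for a given marginal value of the budget -/

/-- The bid that is optimal when the marginal cost of the budget is `x`: it is `-1 / x` for `x < 0`
and `+∞` for `x ≥ 0`, because `ENNReal.ofReal (-x) = 0` and `0⁻¹ = ⊤` there. -/
noncomputable def bidOf (x : ℝ) : ℝ≥0∞ := (ENNReal.ofReal (-x))⁻¹

theorem bidOf_of_nonneg {x : ℝ} (hx : 0 ≤ x) : bidOf x = ⊤ := by
  simp [bidOf, ENNReal.ofReal_of_nonpos (neg_nonpos.2 hx)]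

theorem bidOf_of_neg {x : ℝ} (hx : x < 0) : bidOf x = ENNReal.ofReal (-1 / x) := by
  rw [bidOf, ← ENNReal.ofReal_inv_of_pos (neg_pos.2 hx)]
  congr 1
  rw [inv_neg, neg_div, one_div]

theorem continuous_bidOf : Continuous bidOf :=
  continuous_inv.comp (ENNReal.continuous_ofReal.comp continuous_neg)

theorem monotone_bidOf : Monotone bidOf := fun _ _ h =>
  ENNReal.inv_le_inv.2 (ENNReal.ofReal_le_ofReal (neg_le_neg h))

theorem bidOf_min_zero (x : ℝ) : bidOf (min x 0) = bidOf x := by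
  rcases le_total x 0 with h | h
  · rw [min_eq_left h]
  · rw [min_eq_right h, bidOf_of_nonneg h, bidOf_of_nonneg le_rfl]

/-- The bid `bidOf x` wins exactly the prices whose contribution `f p * (1 + x * p)` is
nonnegative. -/
theorem mem_pricesBelow_bidOf {x p : ℝ} (hp : 0 < p) :
    p ∈ pricesBelow (bidOf x) ↔ 0 ≤ 1 + x * p := by
  rcases le_or_gt 0 x with hx | hx
  · rw [bidOf_of_nonneg hx, pricesBelow_top]
    exact iff_of_true hp (by positivity)
  · rw [bidOf_of_neg hx, pricesBelow_ofReal (div_nonneg_of_nonpos (by norm_num) hx.le), mem_Ioc,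
      le_div_iff_of_neg hx]
    constructor
    · rintro ⟨-, h⟩; linarith
    · intro h; exact ⟨hp, by linarith⟩

/-- The reward rate `F(b) + x G(b)` of the bid `b` when the budget has marginal cost `x`. -/
noncomputable def bidGain (f : ℝ → ℝ) (x : ℝ) (b : ℝ≥0∞) : ℝ :=
  priceCDF f b + x * expectedPayment f b

namespace IsPriceDensity

variable {f : ℝ → ℝ}

theorem integrableOn_gain (hf : IsPriceDensity f) (x : ℝ) :
    IntegrableOn (fun p : ℝ => f p * (1 + x * p)) (Ioi 0) := by
  have := hf.integrableOn.add (hf.integrableOn_id_mul.const_mul x)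
  refine this.congr (Eventually.of_forall fun p => ?_)
  simp only [Pi.add_apply]; ring

theorem bidGain_eq (hf : IsPriceDensity f) (x : ℝ) (b : ℝ≥0∞) :
    bidGain f x b = ∫ p in pricesBelow b, f p * (1 + x * p) := by
  have h1 := hf.integrableOn.mono_set (pricesBelow_subset b)
  have h2 := (hf.integrableOn_id_mul.mono_set (pricesBelow_subset b)).const_mul x
  have h3 : bidGain f x b = (∫ p in pricesBelow b, f p) + x * ∫ p in pricesBelow b, p * f p := rfl
  rw [h3, ← integral_const_mul, ← integral_add h1 h2]
  congr 1
  ext p; ring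

theorem continuous_bidGain (hf : IsPriceDensity f) (x : ℝ) : Continuous (bidGain f x) :=
  hf.continuous_priceCDF.add (continuous_const.mul hf.continuous_expectedPayment)

theorem bidGain_coe (hf : IsPriceDensity f) (x : ℝ) (b : ℝ≥0) :
    bidGain f x b = ∫ p in (0 : ℝ)..(b : ℝ), f p * (1 + x * p) := by
  rw [hf.bidGain_eq, intervalIntegral.integral_of_le b.coe_nonneg,
    ← pricesBelow_ofReal b.coe_nonneg,
    ENNReal.ofReal_coe_nnreal]

/-- The loss of gain caused by a bid that differs from `bidOf x`, written as an integral of a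
nonnegative function. -/
theorem bidGain_bidOf_sub (hf : IsPriceDensity f) (x : ℝ) (b : ℝ≥0∞) :
    bidGain f x (bidOf x) - bidGain f x b = ∫ p in Ioi (0 : ℝ),
      ((pricesBelow (bidOf x)).indicator (fun p => f p * (1 + x * p)) p -
        (pricesBelow b).indicator (fun p => f p * (1 + x * p)) p) := by
  have hi := hf.integrableOn_gain x
  rw [integral_sub (hi.indicator (measurableSet_pricesBelow _))
    (hi.indicator (measurableSet_pricesBelow _)), setIntegral_indicator
    (measurableSet_pricesBelow _), setIntegral_indicator (measurableSet_pricesBelow _),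
    inter_eq_right.2 (pricesBelow_subset _), inter_eq_right.2 (pricesBelow_subset _),
    hf.bidGain_eq, hf.bidGain_eq]

theorem gain_loss_nonneg (hf : IsPriceDensity f) (x : ℝ) (b : ℝ≥0∞) {p : ℝ} (hp : 0 < p) :
    0 ≤ (pricesBelow (bidOf x)).indicator (fun p => f p * (1 + x * p)) p -
        (pricesBelow b).indicator (fun p => f p * (1 + x * p)) p := by
  have hfp := hf.pos p hp
  have hmem := mem_pricesBelow_bidOf (x := x) hp
  by_cases h1 : p ∈ pricesBelow (bidOf x)
  · have := mul_nonneg hfp.le (hmem.1 h1)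
    by_cases h2 : p ∈ pricesBelow b <;> simp [h1, h2, this]
  · have := mul_neg_of_pos_of_neg hfp (not_le.1 fun h => h1 (hmem.2 h))
    by_cases h2 : p ∈ pricesBelow b <;> simp [h1, h2, this.le]

theorem bidGain_le (hf : IsPriceDensity f) (x : ℝ) (b : ℝ≥0∞) :
    bidGain f x b ≤ bidGain f x (bidOf x) := by
  rw [← sub_nonneg, hf.bidGain_bidOf_sub]
  exact setIntegral_nonneg measurableSet_Ioi fun p hp => hf.gain_loss_nonneg x b hp

/-- The bid `bidOf x` is the only maximiser, because `f` is positive. -/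
theorem eq_bidOf_of_bidGain_eq (hf : IsPriceDensity f) {x : ℝ} {b : ℝ≥0∞}
    (h : bidGain f x b = bidGain f x (bidOf x)) : b = bidOf x := by
  by_contra hne
  have hi := hf.integrableOn_gain x
  have h0 := hf.bidGain_bidOf_sub x b
  rw [h, sub_self] at h0
  have hae := (setIntegral_eq_zero_iff_of_nonneg_ae (by
    filter_upwards [ae_restrict_mem measurableSet_Ioi] with p hp
    exact hf.gain_loss_nonneg x b hp) ((hi.indicator (measurableSet_pricesBelow _)).sub
    (hi.indicator (measurableSet_pricesBelow _)))).1 h0.symm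
  -- Prices strictly between the two bids form a nonempty open set, on which the loss is positive.
  set U : Set ℝ := {p | 0 < p ∧ min b (bidOf x) < ENNReal.ofReal p ∧
    ENNReal.ofReal p < max b (bidOf x)} with hU
  have hUo : IsOpen U := (isOpen_Ioi (a := (0 : ℝ))).inter
    ((isOpen_Ioi (a := min b (bidOf x))).preimage ENNReal.continuous_ofReal |>.inter
      ((isOpen_Iio (a := max b (bidOf x))).preimage ENNReal.continuous_ofReal))
  have hUne : U.Nonempty := by
    obtain ⟨c, hc1, hc2⟩ := ENNReal.lt_iff_exists_nnreal_btwn.1 (min_lt_max.2 hne)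
    refine ⟨c, ?_, ?_, ?_⟩
    · have : (0 : ℝ≥0∞) < c := lt_of_le_of_lt zero_le hc1
      exact_mod_cast this
    · rwa [ENNReal.ofReal_coe_nnreal]
    · rwa [ENNReal.ofReal_coe_nnreal]
  have hUsub : ∀ᵐ p ∂(volume.restrict (Ioi (0 : ℝ))), p ∉ U := by
    have hne' : ∀ᵐ p ∂(volume.restrict (Ioi (0 : ℝ))), p ≠ -1 / x :=
      ae_restrict_of_ae (Measure.ae_ne volume _)
    filter_upwards [hae, hne', ae_restrict_mem measurableSet_Ioi] with p hp hpx hp0 hpU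
    have hp0' : (0 : ℝ) < p := hp0
    have hnz : f p * (1 + x * p) ≠ 0 := by
      refine mul_ne_zero (hf.pos p hp0').ne' fun h1 => hpx ?_
      have hx : x ≠ 0 := by rintro rfl; simp at h1
      rw [eq_div_iff hx]; linarith
    obtain ⟨-, h1, h2⟩ := hpU
    rcases le_total b (bidOf x) with hle | hle
    · rw [min_eq_left hle] at h1
      rw [max_eq_right hle] at h2
      have m1 : p ∈ pricesBelow (bidOf x) := ⟨hp0', h2.le⟩
      have m2 : p ∉ pricesBelow b := fun m => absurd m.2 (not_le.2 h1)
      simp only [Pi.zero_apply, Pi.sub_apply, indicator_of_mem m1, indicator_of_notMem m2,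
        sub_zero] at hp
      exact hnz hp
    · rw [min_eq_right hle] at h1
      rw [max_eq_left hle] at h2
      have m1 : p ∉ pricesBelow (bidOf x) := fun m => absurd m.2 (not_le.2 h1)
      have m2 : p ∈ pricesBelow b := ⟨hp0', h2.le⟩
      simp only [Pi.zero_apply, Pi.sub_apply, indicator_of_mem m2, indicator_of_notMem m1, zero_sub,
        neg_eq_zero] at hp
      exact hnz hp
  have hU0 : volume U = 0 := by
    have hz := measure_eq_zero_iff_ae_notMem.2 hUsub
    rwa [Measure.restrict_apply hUo.measurableSet,
      inter_eq_left.2 (show U ⊆ Ioi 0 from fun p hp => hp.1)] at hz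
  exact (hUo.measure_pos volume hUne).ne' hU0

end IsPriceDensity

/-! ### The Hamiltonian -/

/-- The rate `λ G(b)` at which the bid `bidOf x` spends; it is the derivative of the Hamiltonian. -/
noncomputable def spendRate (lam : ℝ) (f : ℝ → ℝ) (x : ℝ) : ℝ := lam * expectedPayment f (bidOf x)

namespace IsPriceDensity

variable {f : ℝ → ℝ} {lam : ℝ}

theorem isLUB_bidGain (hf : IsPriceDensity f) (x : ℝ) :
    IsLUB (range fun b : ℝ≥0 => ∫ p in (0 : ℝ)..(b : ℝ), f p * (1 + x * p))
      (bidGain f x (bidOf x)) := by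
  constructor
  · rintro _ ⟨b, rfl⟩
    simp only [← hf.bidGain_coe]
    exact hf.bidGain_le x b
  · intro c hc
    have hcl : IsClosed {b : ℝ≥0∞ | bidGain f x b ≤ c} :=
      isClosed_le (hf.continuous_bidGain x) continuous_const
    -- Finite bids are dense in `[0, ∞]`.
    have hd : Dense (range ((↑) : ℝ≥0 → ℝ≥0∞)) := dense_of_exists_between fun _ _ hab => by
      obtain ⟨r, h1, h2⟩ := ENNReal.lt_iff_exists_nnreal_btwn.1 hab
      exact ⟨r, mem_range_self r, h1, h2⟩
    have hsub : range ((↑) : ℝ≥0 → ℝ≥0∞) ⊆ {b : ℝ≥0∞ | bidGain f x b ≤ c} := by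
      rintro _ ⟨b, rfl⟩
      have := hc ⟨b, rfl⟩
      simpa only [mem_ofPred_eq, hf.bidGain_coe] using this
    exact hcl.closure_subset_iff.2 hsub (hd (bidOf x))

theorem hamiltonian_eq (hf : IsPriceDensity f) (lam x : ℝ) :
    hamiltonian lam f x = lam * bidGain f x (bidOf x) := by
  rw [hamiltonian, ← (hf.isLUB_bidGain x).csSup_eq (range_nonempty _)]; rfl

theorem hamiltonian_eq_neg_iInf (hf : IsPriceDensity f) (lam x : ℝ) :
    hamiltonian lam f x =
      -(lam * ⨅ b : ℝ≥0, -∫ p in (0 : ℝ)..(b : ℝ), f p * (1 + x * p)) := by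
  have h : IsGLB (range fun b : ℝ≥0 => -∫ p in (0 : ℝ)..(b : ℝ), f p * (1 + x * p))
      (-bidGain f x (bidOf x)) := by
    refine ⟨?_, fun c hc => le_neg.1 ((hf.isLUB_bidGain x).2 ?_)⟩
    · rintro _ ⟨b, rfl⟩
      exact neg_le_neg ((hf.isLUB_bidGain x).1 ⟨b, rfl⟩)
    · rintro _ ⟨b, rfl⟩
      exact le_neg.1 (hc ⟨b, rfl⟩)
  rw [hf.hamiltonian_eq, show (⨅ b : ℝ≥0, -∫ p in (0 : ℝ)..(b : ℝ), f p * (1 + x * p)) =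
    -bidGain f x (bidOf x) from h.csInf_eq (range_nonempty _)]
  ring

theorem le_hamiltonian (hf : IsPriceDensity f) (hlam : 0 < lam) (x : ℝ) (b : ℝ≥0∞) :
    lam * bidGain f x b ≤ hamiltonian lam f x := by
  rw [hf.hamiltonian_eq]
  exact mul_le_mul_of_nonneg_left (hf.bidGain_le x b) hlam.le

theorem hamiltonian_subgradient (hf : IsPriceDensity f) (hlam : 0 < lam) (x y : ℝ) :
    hamiltonian lam f x + spendRate lam f x * (y - x) ≤ hamiltonian lam f y := by
  refine le_trans (le_of_eq ?_) (hf.le_hamiltonian hlam y (bidOf x))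
  rw [hf.hamiltonian_eq, spendRate, bidGain, bidGain]
  ring

theorem continuous_spendRate (hf : IsPriceDensity f) (lam : ℝ) : Continuous (spendRate lam f) :=
  continuous_const.mul (hf.continuous_expectedPayment.comp continuous_bidOf)

theorem monotone_spendRate (hf : IsPriceDensity f) (hlam : 0 < lam) :
    Monotone (spendRate lam f) := fun _ _ h =>
  mul_le_mul_of_nonneg_left (hf.monotone_expectedPayment (monotone_bidOf h)) hlam.le

theorem spendRate_nonneg (hf : IsPriceDensity f) (hlam : 0 < lam) (x : ℝ) :
    0 ≤ spendRate lam f x := mul_nonneg hlam.le (hf.expectedPayment_nonneg _)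

theorem spendRate_of_nonneg (lam : ℝ) (f : ℝ → ℝ) {x : ℝ} (hx : 0 ≤ x) :
    spendRate lam f x = lam * meanPrice f := by
  rw [spendRate, bidOf_of_nonneg hx, expectedPayment_top]

theorem spendRate_le (hf : IsPriceDensity f) (hlam : 0 < lam) (x : ℝ) :
    spendRate lam f x ≤ lam * meanPrice f := by
  rw [← expectedPayment_top]
  exact mul_le_mul_of_nonneg_left (hf.monotone_expectedPayment le_top) hlam.le

theorem hasDerivAt_hamiltonian (hf : IsPriceDensity f) (hlam : 0 < lam) (x : ℝ) :
    HasDerivAt (hamiltonian lam f) (spendRate lam f x) x :=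
  hasDerivAt_of_continuousAt_subgradient (Eventually.of_forall fun y =>
    ⟨hf.hamiltonian_subgradient hlam x y, hf.hamiltonian_subgradient hlam y x⟩)
    (hf.continuous_spendRate lam).continuousAt

theorem monotone_hamiltonian (hf : IsPriceDensity f) (hlam : 0 < lam) :
    Monotone (hamiltonian lam f) := fun x y h => by
  nlinarith [hf.hamiltonian_subgradient hlam x y,
    mul_nonneg (hf.spendRate_nonneg hlam x) (sub_nonneg.2 h)]

theorem hamiltonian_sub_le (hf : IsPriceDensity f) (hlam : 0 < lam) {x y : ℝ} (h : x ≤ y) :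
    hamiltonian lam f y - hamiltonian lam f x ≤ lam * meanPrice f * (y - x) := by
  nlinarith [hf.hamiltonian_subgradient hlam y x,
    mul_nonneg (sub_nonneg.2 (hf.spendRate_le hlam y)) (sub_nonneg.2 h)]

theorem meanPrice_nonneg (hf : IsPriceDensity f) : 0 ≤ meanPrice f := by
  rw [← expectedPayment_top]; exact hf.expectedPayment_nonneg ⊤

theorem hamiltonian_of_nonneg (hf : IsPriceDensity f) (lam : ℝ) {x : ℝ} (hx : 0 ≤ x) :
    hamiltonian lam f x = lam * (1 + x * meanPrice f) := by
  rw [hf.hamiltonian_eq, bidOf_of_nonneg hx, bidGain, hf.priceCDF_top, expectedPayment_top]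

/-- `∫₀ᴮ F = B F(B) - G(B)`: as a function of `B` the right-hand side is the supremum over `b` of
`B F(b) - G(b)`, so that `F` is a continuous subgradient of it. -/
theorem integral_priceCDF (hf : IsPriceDensity f) {B : ℝ} (hB : 0 ≤ B) :
    ∫ p in (0 : ℝ)..B, priceCDF f (ENNReal.ofReal p) =
      B * priceCDF f (ENNReal.ofReal B) - expectedPayment f (ENNReal.ofReal B) := by
  have hcont : Continuous fun p : ℝ => priceCDF f (ENNReal.ofReal p) :=
    hf.continuous_priceCDF.comp ENNReal.continuous_ofReal
  have key : ∀ b c : ℝ, 0 < b → b * priceCDF f (ENNReal.ofReal c) -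
      expectedPayment f (ENNReal.ofReal c) ≤ b * priceCDF f (ENNReal.ofReal b) -
      expectedPayment f (ENNReal.ofReal b) := by
    intro b c hb
    have h := hf.bidGain_le (-1 / b) (ENNReal.ofReal c)
    rw [bidOf_of_neg (div_neg_of_neg_of_pos (by norm_num) hb),
      show -1 / (-1 / b) = b by field_simp] at h
    have h2 : ∀ e, b * bidGain f (-1 / b) e = b * priceCDF f e - expectedPayment f e := by
      intro e; rw [bidGain]; field_simp; ring
    rw [← h2, ← h2]
    exact mul_le_mul_of_nonneg_left h hb.le
  have hG : Continuous fun p : ℝ => expectedPayment f (ENNReal.ofReal p) :=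
    hf.continuous_expectedPayment.comp ENNReal.continuous_ofReal
  rw [intervalIntegral.integral_eq_sub_of_hasDerivAt_of_le hB
    (f := fun p => p * priceCDF f (ENNReal.ofReal p) - expectedPayment f (ENNReal.ofReal p))
    ((continuous_id.mul hcont).sub hG).continuousOn _ (hcont.intervalIntegrable _ _)]
  · have h0 : expectedPayment f (ENNReal.ofReal 0) = 0 := by
      have h : expectedPayment f (ENNReal.ofReal 0) =
        ∫ p in pricesBelow (ENNReal.ofReal 0), p * f p := rfl
      rw [h, pricesBelow_ofReal le_rfl]; simp
    rw [h0]; ring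
  · intro p hp
    refine hasDerivAt_of_continuousAt_subgradient
      (g := fun p : ℝ => priceCDF f (ENNReal.ofReal p)) ?_ hcont.continuousAt
    filter_upwards [lt_mem_nhds hp.1] with q hq
    have h1 := key p q hp.1
    have h2 := key q p hq
    constructor <;> linarith

theorem hamiltonian_of_neg (hf : IsPriceDensity f) (lam : ℝ) {x : ℝ} (hx : x < 0) :
    hamiltonian lam f x =
      -lam * x * ∫ p in (0 : ℝ)..(-1 / x), priceCDF f (ENNReal.ofReal p) := by
  rw [hf.hamiltonian_eq, hf.integral_priceCDF (div_nonneg_of_nonpos (by norm_num) hx.le),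
    bidOf_of_neg hx, bidGain]
  have := hx.ne
  field_simp
  ring

end IsPriceDensity

/-! ### The costate and the dual problem -/

/-- The solution `x` of `S = τ H'(x) + x / (2 K)`, which exists and is unique for `τ ≥ 0`
and `K > 0`. -/
noncomputable def costate (lam K : ℝ) (f : ℝ → ℝ) (τ S : ℝ) : ℝ :=
  Classical.epsilon fun x : ℝ => τ * spendRate lam f x + x / (2 * K) = S

/-- The maximiser over `x ≤ 0` of `S x - τ H(x) - x² / (4 K)`. -/
noncomputable def dualPoint (lam K : ℝ) (f : ℝ → ℝ) (τ S : ℝ) : ℝ := min (costate lam K f τ S) 0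

/-- The objective of the dual problem with time to go `τ` and budget `S`. -/
noncomputable def dualObjective (lam K : ℝ) (f : ℝ → ℝ) (τ S x : ℝ) : ℝ :=
  S * x - τ * hamiltonian lam f x - x ^ 2 / (4 * K)

/-- The maximum of the dual objective over `x ≤ 0`. -/
noncomputable def dualValue (lam K : ℝ) (f : ℝ → ℝ) (τ S : ℝ) : ℝ :=
  dualObjective lam K f τ S (dualPoint lam K f τ S)

section

variable {f : ℝ → ℝ} {lam K τ S : ℝ}

theorem IsPriceDensity.costate_spec (hf : IsPriceDensity f) (hlam : 0 < lam) (hK : 0 < K)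
    (hτ : 0 ≤ τ) (S : ℝ) :
    τ * spendRate lam f (costate lam K f τ S) + costate lam K f τ S / (2 * K) = S := by
  have hex : ∃ x : ℝ, τ * spendRate lam f x + x / (2 * K) = S := by
    have hc : Continuous fun x : ℝ => τ * spendRate lam f x + x / (2 * K) :=
      (continuous_const.mul (hf.continuous_spendRate lam)).add (continuous_id.div_const _)
    set N := τ * (lam * meanPrice f) with hN
    have hN0 : 0 ≤ N := mul_nonneg hτ (mul_nonneg hlam.le hf.meanPrice_nonneg)
    have hlow : 2 * K * (S - N) ≤ 2 * K * S := by nlinarith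
    obtain ⟨x, -, hx⟩ := intermediate_value_Icc hlow hc.continuousOn (show S ∈ _ from by
      constructor
      · have h1 := mul_le_mul_of_nonneg_left (hf.spendRate_le hlam (2 * K * (S - N))) hτ
        have h2 : 2 * K * (S - N) / (2 * K) = S - N := by field_simp
        simp only [h2]; linarith
      · have h1 := mul_nonneg hτ (hf.spendRate_nonneg hlam (2 * K * S))
        have h2 : 2 * K * S / (2 * K) = S := by field_simp
        simp only [h2]; linarith)
    exact ⟨x, hx⟩
  exact Classical.epsilon_spec hex

/-- The solution depends on the data in a Lipschitz way, because `H'` is nondecreasing. -/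
theorem IsPriceDensity.sub_le_of_costate_eq (hf : IsPriceDensity f) (hlam : 0 < lam) (hK : 0 < K)
    {τ' S' x x' : ℝ} (hτ' : 0 ≤ τ') (hx : τ * spendRate lam f x + x / (2 * K) = S)
    (hx' : τ' * spendRate lam f x' + x' / (2 * K) = S') (hle : x ≤ x') :
    x' - x ≤ 2 * K * (S' - S + (τ - τ') * spendRate lam f x) := by
  have h1 := mul_nonneg hτ' (sub_nonneg.2 (hf.monotone_spendRate hlam hle))
  have h2 : x / (2 * K) = S - τ * spendRate lam f x := by linarith
  have h3 : x' / (2 * K) = S' - τ' * spendRate lam f x' := by linarith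
  rw [div_eq_iff (by positivity)] at h2 h3
  have h4 := mul_nonneg (show 0 ≤ 2 * K by positivity) h1
  linarith

theorem IsPriceDensity.costate_unique (hf : IsPriceDensity f) (hlam : 0 < lam) (hK : 0 < K)
    (hτ : 0 ≤ τ) {x : ℝ} (hx : τ * spendRate lam f x + x / (2 * K) = S) :
    x = costate lam K f τ S := by
  have h := hf.costate_spec hlam hK hτ S
  rcases le_total x (costate lam K f τ S) with hle | hle
  · have := hf.sub_le_of_costate_eq hlam hK hτ hx h hle
    simp only [sub_self, zero_mul, add_zero, mul_zero] at this
    linarith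
  · have := hf.sub_le_of_costate_eq hlam hK hτ h hx hle
    simp only [sub_self, zero_mul, add_zero, mul_zero] at this
    linarith

theorem IsPriceDensity.abs_costate_sub_le (hf : IsPriceDensity f) (hlam : 0 < lam) (hK : 0 < K)
    {τ' : ℝ} (hτ : 0 ≤ τ) (hτ' : 0 ≤ τ') (S S' : ℝ) :
    |costate lam K f τ' S' - costate lam K f τ S| ≤
      2 * K * (|S' - S| + lam * meanPrice f * |τ' - τ|) := by
  have key : ∀ {τ τ' : ℝ} (S S' : ℝ), 0 ≤ τ → 0 ≤ τ' →
      costate lam K f τ S ≤ costate lam K f τ' S' →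
      |costate lam K f τ' S' - costate lam K f τ S| ≤
        2 * K * (|S' - S| + lam * meanPrice f * |τ' - τ|) := by
    intro τ τ' S S' hτ hτ' hle
    rw [abs_of_nonneg (sub_nonneg.2 hle)]
    refine (hf.sub_le_of_costate_eq hlam hK hτ' (hf.costate_spec hlam hK hτ S)
      (hf.costate_spec hlam hK hτ' S') hle).trans ?_
    refine mul_le_mul_of_nonneg_left (add_le_add (le_abs_self _) ?_) (by positivity)
    rw [mul_comm (lam * meanPrice f), abs_sub_comm]
    exact mul_le_mul (le_abs_self _) (hf.spendRate_le hlam _) (hf.spendRate_nonneg hlam _)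
      (abs_nonneg _)
  rcases le_total (costate lam K f τ S) (costate lam K f τ' S') with hle | hle
  · exact key S S' hτ hτ' hle
  · rw [abs_sub_comm, abs_sub_comm S', abs_sub_comm τ']
    exact key S' S hτ' hτ hle

theorem IsPriceDensity.monotone_costate (hf : IsPriceDensity f) (hlam : 0 < lam) (hK : 0 < K)
    (hτ : 0 ≤ τ) : Monotone (costate lam K f τ) := by
  intro S S' hS
  by_contra! hlt
  have := hf.sub_le_of_costate_eq hlam hK hτ (hf.costate_spec hlam hK hτ S')
      (hf.costate_spec hlam hK hτ S) hlt.le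
  simp only [sub_self, zero_mul, add_zero] at this
  nlinarith

theorem IsPriceDensity.continuousOn_dualPoint (hf : IsPriceDensity f) (hlam : 0 < lam)
    (hK : 0 < K) :
    ContinuousOn (fun z : ℝ × ℝ => dualPoint lam K f z.1 z.2) (Ici 0 ×ˢ univ) := by
  refine ContinuousOn.inf ?_ continuousOn_const
  intro z hz
  rw [ContinuousWithinAt, tendsto_iff_dist_tendsto_zero]
  have hb : Tendsto (fun y : ℝ × ℝ => 2 * K * (|y.2 - z.2| + lam * meanPrice f * |y.1 - z.1|))
      (𝓝[Ici 0 ×ˢ univ] z) (𝓝 0) := by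
    have hc : Continuous fun y : ℝ × ℝ =>
      2 * K * (|y.2 - z.2| + lam * meanPrice f * |y.1 - z.1|) := by fun_prop
    have := (hc.tendsto z).mono_left (nhdsWithin_le_nhds (s := Ici 0 ×ˢ univ))
    simpa using this
  refine squeeze_zero' (Eventually.of_forall fun _ => dist_nonneg) ?_ hb
  filter_upwards [self_mem_nhdsWithin] with y hy
  exact hf.abs_costate_sub_le hlam hK hz.1 hy.1 _ _

theorem dualPoint_nonpos : dualPoint lam K f τ S ≤ 0 := min_le_right _ _

theorem spendRate_dualPoint :
    spendRate lam f (dualPoint lam K f τ S) = spendRate lam f (costate lam K f τ S) := by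
  rw [spendRate, dualPoint, bidOf_min_zero]; rfl

theorem IsPriceDensity.abs_dualPoint_sub_le (hf : IsPriceDensity f) (hlam : 0 < lam) (hK : 0 < K)
    (hτ : 0 ≤ τ) (S S' : ℝ) :
    |dualPoint lam K f τ S' - dualPoint lam K f τ S| ≤ 2 * K * |S' - S| := by
  have h := hf.abs_costate_sub_le hlam hK hτ hτ S S'
  rw [sub_self, abs_zero, mul_zero, add_zero] at h
  exact (abs_inf_sub_inf_le_abs _ _ _).trans h

theorem IsPriceDensity.dualObjective_le (hf : IsPriceDensity f) (hlam : 0 < lam) (hK : 0 < K)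
    (hτ : 0 ≤ τ) (S : ℝ) {x : ℝ} (hx : x ≤ 0) :
    dualObjective lam K f τ S x ≤ dualValue lam K f τ S := by
  have hs := hf.costate_spec hlam hK hτ S
  rw [← spendRate_dualPoint] at hs
  have hsub := mul_le_mul_of_nonneg_left
    (hf.hamiltonian_subgradient hlam (dualPoint lam K f τ S) x) hτ
  -- First order optimality: the objective is increasing at the maximiser only if that is `0`.
  have hopt : (S - τ * spendRate lam f (dualPoint lam K f τ S) -
      dualPoint lam K f τ S / (2 * K)) * (x - dualPoint lam K f τ S) ≤ 0 := by
    rcases le_total (costate lam K f τ S) 0 with h | h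
    · have h1 : dualPoint lam K f τ S = costate lam K f τ S := min_eq_left h
      rw [← h1] at hs
      rw [show S - τ * spendRate lam f (dualPoint lam K f τ S) -
        dualPoint lam K f τ S / (2 * K) = 0 by linarith, zero_mul]
    · have h1 : dualPoint lam K f τ S = 0 := min_eq_right h
      have h2 : 0 ≤ costate lam K f τ S / (2 * K) := by positivity
      rw [h1] at hs ⊢
      refine mul_nonpos_of_nonneg_of_nonpos ?_ (by linarith)
      rw [zero_div]; linarith
  have hsq : 0 ≤ (x - dualPoint lam K f τ S) ^ 2 / (4 * K) := by positivity
  have hid : x ^ 2 / (4 * K) = dualPoint lam K f τ S ^ 2 / (4 * K) +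
      dualPoint lam K f τ S / (2 * K) * (x - dualPoint lam K f τ S) +
      (x - dualPoint lam K f τ S) ^ 2 / (4 * K) := by
    field_simp; ring
  rw [dualValue, dualObjective, dualObjective, hid]
  nlinarith

theorem IsPriceDensity.isLUB_dualValue (hf : IsPriceDensity f) (hlam : 0 < lam) (hK : 0 < K)
    (hτ : 0 ≤ τ) (S : ℝ) :
    IsLUB (dualObjective lam K f τ S '' Iic 0) (dualValue lam K f τ S) := by
  refine IsGreatest.isLUB ⟨⟨_, dualPoint_nonpos, rfl⟩, ?_⟩
  rintro _ ⟨x, hx, rfl⟩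
  exact hf.dualObjective_le hlam hK hτ S hx

/-! ### Regularity of the dual value -/

/-- The dual value is a supremum of affine functions of `(τ, S)`. -/
theorem IsPriceDensity.dualValue_subgradient (hf : IsPriceDensity f) (hlam : 0 < lam) (hK : 0 < K)
    {τ' : ℝ} (hτ' : 0 ≤ τ') (τ S S' : ℝ) :
    dualValue lam K f τ S + dualPoint lam K f τ S * (S' - S) -
      hamiltonian lam f (dualPoint lam K f τ S) * (τ' - τ) ≤ dualValue lam K f τ' S' := by
  refine le_trans (le_of_eq ?_) (hf.dualObjective_le hlam hK hτ' S'
    (dualPoint_nonpos (lam := lam) (K := K) (f := f) (τ := τ) (S := S)))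
  rw [dualValue, dualObjective, dualObjective]
  ring

theorem IsPriceDensity.hasDerivAt_dualValue_budget (hf : IsPriceDensity f) (hlam : 0 < lam)
    (hK : 0 < K) (hτ : 0 ≤ τ) (S : ℝ) :
    HasDerivAt (dualValue lam K f τ) (dualPoint lam K f τ S) S := by
  refine hasDerivAt_of_continuousAt_subgradient (g := dualPoint lam K f τ)
    (Eventually.of_forall fun y => ⟨?_, ?_⟩) ?_
  · simpa using hf.dualValue_subgradient hlam hK hτ τ S y
  · simpa using hf.dualValue_subgradient hlam hK hτ τ y S
  · have h : Continuous (dualPoint lam K f τ) :=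
      (hf.continuousOn_dualPoint hlam hK).comp_continuous (f := fun y => (τ, y)) (by fun_prop)
        fun y => ⟨hτ, mem_univ _⟩
    exact h.continuousAt

theorem IsPriceDensity.hasDerivAt_dualValue_time (hf : IsPriceDensity f) (hlam : 0 < lam)
    (hK : 0 < K) (hτ : 0 < τ) (S : ℝ) :
    HasDerivAt (fun r => dualValue lam K f r S)
      (-hamiltonian lam f (dualPoint lam K f τ S)) τ := by
  refine hasDerivAt_of_continuousAt_subgradient
    (g := fun r => -hamiltonian lam f (dualPoint lam K f r S)) ?_ ?_
  · filter_upwards [lt_mem_nhds hτ] with r hr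
    have h1 := hf.dualValue_subgradient hlam hK hr.le τ S S
    have h2 := hf.dualValue_subgradient hlam hK hτ.le r S S
    constructor <;> linarith
  · have hc : ContinuousAt (fun r => dualPoint lam K f r S) τ :=
      ((hf.continuousOn_dualPoint hlam hK).comp (f := fun r : ℝ => (r, S)) (s := Ici 0)
        (by fun_prop) fun r hr => ⟨hr, mem_univ _⟩).continuousAt (Ici_mem_nhds hτ)
    have hH := (hf.hasDerivAt_hamiltonian hlam (dualPoint lam K f τ S)).continuousAt
    exact (ContinuousAt.comp (f := fun r => dualPoint lam K f r S) hH hc).neg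

theorem IsPriceDensity.locallyLipschitzOn_dualValue (hf : IsPriceDensity f) (hlam : 0 < lam)
    (hK : 0 < K) :
    LocallyLipschitzOn (Ici 0 ×ˢ univ) (fun z : ℝ × ℝ => dualValue lam K f z.1 z.2) := by
  intro z hz
  have hcξ := hf.continuousOn_dualPoint hlam hK z hz
  have hcH : ContinuousWithinAt (fun y : ℝ × ℝ => hamiltonian lam f (dualPoint lam K f y.1 y.2))
      (Ici 0 ×ˢ univ) z :=
    (hf.hasDerivAt_hamiltonian hlam (dualPoint lam K f z.1 z.2)
      ).continuousAt.comp_continuousWithinAt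
      (f := fun y : ℝ × ℝ => dualPoint lam K f y.1 y.2) hcξ
  set L : ℝ := |dualPoint lam K f z.1 z.2| + |hamiltonian lam f (dualPoint lam K f z.1 z.2)| + 1
    with hL
  have hev : ∀ᶠ y : ℝ × ℝ in 𝓝[Ici 0 ×ˢ univ] z,
      |dualPoint lam K f y.1 y.2| + |hamiltonian lam f (dualPoint lam K f y.1 y.2)| < L :=
    (hcξ.abs.add hcH.abs).eventually (gt_mem_nhds (lt_add_one _))
  refine ⟨L.toNNReal, _, Filter.inter_mem self_mem_nhdsWithin hev, ?_⟩
  have hle : ∀ y ∈ (Ici (0 : ℝ) ×ˢ (univ : Set ℝ)), ∀ w : ℝ × ℝ,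
      |dualPoint lam K f w.1 w.2| + |hamiltonian lam f (dualPoint lam K f w.1 w.2)| < L →
      dualValue lam K f w.1 w.2 - dualValue lam K f y.1 y.2 ≤ L * dist w y := by
    intro y hy w hw
    have h := hf.dualValue_subgradient hlam hK hy.1 w.1 w.2 y.2
    have d1 : |y.1 - w.1| ≤ dist w y := by
      rw [dist_comm, Prod.dist_eq, Real.dist_eq]; exact le_max_left _ _
    have d2 : |y.2 - w.2| ≤ dist w y := by
      rw [dist_comm, Prod.dist_eq, Real.dist_eq, Real.dist_eq]; exact le_max_right _ _
    have e1 : -(dualPoint lam K f w.1 w.2 * (y.2 - w.2)) ≤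
        |dualPoint lam K f w.1 w.2| * dist w y := by
      refine (neg_le_abs _).trans ?_
      rw [abs_mul]; gcongr
    have e2 : hamiltonian lam f (dualPoint lam K f w.1 w.2) * (y.1 - w.1) ≤
        |hamiltonian lam f (dualPoint lam K f w.1 w.2)| * dist w y := by
      refine (le_abs_self _).trans ?_
      rw [abs_mul]; gcongr
    have e3 := mul_le_mul_of_nonneg_right hw.le (dist_nonneg (x := w) (y := y))
    linarith
  refine LipschitzOnWith.of_dist_le_mul fun y hy w hw => ?_
  rw [Real.coe_toNNReal L (by positivity), Real.dist_eq, abs_le]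
  have h1 := hle y hy.1 w hw.2
  have h2 := hle w hw.1 y hy.2
  rw [dist_comm] at h1
  constructor <;> linarith

theorem IsPriceDensity.dualValue_semiconcave (hf : IsPriceDensity f) (hlam : 0 < lam)
    (hK : 0 < K) (hτ : 0 ≤ τ) (S z : ℝ) :
    dualValue lam K f τ (S + z) - 2 * dualValue lam K f τ S + dualValue lam K f τ (S - z) ≤
      4 * K * z ^ 2 := by
  have h1 := hf.dualValue_subgradient hlam hK hτ τ (S + z) S
  have h2 := hf.dualValue_subgradient hlam hK hτ τ (S - z) S
  have h3 := hf.abs_dualPoint_sub_le hlam hK hτ (S - z) (S + z)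
  have h4 : (dualPoint lam K f τ (S + z) - dualPoint lam K f τ (S - z)) * z ≤ 4 * K * z ^ 2 := by
    refine (le_abs_self _).trans ?_
    rw [abs_mul]
    refine (mul_le_mul_of_nonneg_right h3 (abs_nonneg z)).trans (le_of_eq ?_)
    rw [show S + z - (S - z) = 2 * z by ring, abs_mul, abs_two, ← sq_abs z]
    ring
  simp only [sub_self, mul_zero, sub_zero] at h1 h2
  linarith

theorem IsPriceDensity.dualValue_zero (hf : IsPriceDensity f) (hlam : 0 < lam) (hK : 0 < K)
    (S : ℝ) : dualValue lam K f 0 S = K * min S 0 ^ 2 := by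
  have hs := hf.costate_spec hlam hK le_rfl S
  rw [zero_mul, zero_add, div_eq_iff (by positivity)] at hs
  rw [dualValue, dualObjective, dualPoint, hs]
  rcases le_total S 0 with h | h
  · rw [min_eq_left h, min_eq_left (by nlinarith)]; field_simp; ring
  · rw [min_eq_right h, min_eq_right (by positivity)]; simp

end

/-! ### Duality between controls and costates -/

theorem Continuous.intervalIntegrable_comp_bid {φ : ℝ≥0∞ → ℝ} (hφ : Continuous φ)
    {b : ℝ → ℝ≥0∞} (hb : Measurable b) (t s : ℝ) :
    IntervalIntegrable (fun r => φ (b r)) volume t s := by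
  obtain ⟨C, hC⟩ := isCompact_univ.exists_bound_of_continuousOn hφ.continuousOn
  refine (intervalIntegrable_const (c := C)).mono_fun
    (hφ.measurable.comp hb).aestronglyMeasurable (Eventually.of_forall fun r => ?_)
  exact (hC _ (mem_univ _)).trans (le_abs_self _)

section

variable {f : ℝ → ℝ} {lam K T t S : ℝ} {b : ℝ → ℝ≥0∞}

/-- The duality gap of a control and a costate `x` is the sum of a terminal gap and of the
accumulated loss of gain of the bids compared with `bidOf x`. -/
theorem IsPriceDensity.cost_sub_dualObjective (hf : IsPriceDensity f) (hb : Measurable b)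
    (lam K T t S x : ℝ) :
    cost lam K T f t S b - dualObjective lam K f (T - t) S x =
      (K * min (budget lam f b t S T) 0 ^ 2 - x * budget lam f b t S T + x ^ 2 / (4 * K)) +
        ∫ s in t..T, (hamiltonian lam f x - lam * bidGain f x (b s)) := by
  have hF := hf.continuous_priceCDF.intervalIntegrable_comp_bid hb t T
  have hG := hf.continuous_expectedPayment.intervalIntegrable_comp_bid hb t T
  have h : ∫ s in t..T, (hamiltonian lam f x - lam * bidGain f x (b s)) =
      (T - t) * hamiltonian lam f x - lam * ((∫ s in t..T, priceCDF f (b s)) +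
        x * ∫ s in t..T, expectedPayment f (b s)) := by
    simp only [bidGain]
    rw [intervalIntegral.integral_sub intervalIntegrable_const
      ((hF.add (hG.const_mul x)).const_mul lam), intervalIntegral.integral_const,
      intervalIntegral.integral_const_mul, intervalIntegral.integral_add hF (hG.const_mul x),
      intervalIntegral.integral_const_mul, smul_eq_mul]
  rw [h, cost, dualObjective, budget]
  ring

theorem terminal_gap_nonneg (hK : 0 < K) {x : ℝ} (hx : x ≤ 0) (y : ℝ) :
    0 ≤ K * min y 0 ^ 2 - x * y + x ^ 2 / (4 * K) := by
  have h1 : x * y ≤ x * min y 0 := mul_le_mul_of_nonpos_left (min_le_left _ _) hx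
  have h2 : 0 ≤ (2 * K * min y 0 - x) ^ 2 / (4 * K) := by positivity
  have h3 : (2 * K * min y 0 - x) ^ 2 / (4 * K) =
      K * min y 0 ^ 2 - x * min y 0 + x ^ 2 / (4 * K) := by field_simp; ring
  linarith

theorem IsPriceDensity.integral_loss_nonneg (hf : IsPriceDensity f) (hlam : 0 < lam) (htT : t ≤ T)
    (x : ℝ) (b : ℝ → ℝ≥0∞) :
    0 ≤ ∫ s in t..T, (hamiltonian lam f x - lam * bidGain f x (b s)) :=
  intervalIntegral.integral_nonneg htT fun s _ => sub_nonneg.2 (hf.le_hamiltonian hlam x (b s))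

theorem IsPriceDensity.dualValue_le_cost (hf : IsPriceDensity f) (hlam : 0 < lam) (hK : 0 < K)
    (htT : t ≤ T) (S : ℝ) (hb : Measurable b) :
    dualValue lam K f (T - t) S ≤ cost lam K T f t S b := by
  have h := hf.cost_sub_dualObjective hb lam K T t S (dualPoint lam K f (T - t) S)
  have h1 := terminal_gap_nonneg hK (dualPoint_nonpos (lam := lam) (K := K) (f := f)
    (τ := T - t) (S := S)) (budget lam f b t S T)
  have h2 := hf.integral_loss_nonneg hlam htT (dualPoint lam K f (T - t) S) b
  rw [dualValue]
  linarith

theorem budget_of_ae_eq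
    (h : ∀ᵐ r ∂(volume.restrict (Icc t T)), b r = bidOf (costate lam K f (T - t) S))
    {s : ℝ} (hs : s ∈ Icc t T) :
    budget lam f b t S s = S - (s - t) * spendRate lam f (costate lam K f (T - t) S) := by
  have hi : ∫ r in t..s, expectedPayment f (b r) =
      ∫ r in t..s, expectedPayment f (bidOf (costate lam K f (T - t) S)) := by
    refine intervalIntegral.integral_congr_ae_restrict ?_
    rw [uIoc_of_le hs.1]
    have h' := ae_restrict_of_ae_restrict_of_subset
      (Ioc_subset_Icc_self.trans (Icc_subset_Icc_right hs.2)) h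
    filter_upwards [h'] with r hr
    rw [hr]
  rw [budget, hi, intervalIntegral.integral_const, smul_eq_mul, spendRate]
  ring

/-- A control attains the dual value exactly if it bids `bidOf` of the initial costate
throughout. -/
theorem IsPriceDensity.cost_eq_dualValue_iff (hf : IsPriceDensity f) (hlam : 0 < lam) (hK : 0 < K)
    (htT : t ≤ T) (S : ℝ) (hb : Measurable b) :
    cost lam K T f t S b = dualValue lam K f (T - t) S ↔
      ∀ᵐ s ∂(volume.restrict (Icc t T)), b s = bidOf (costate lam K f (T - t) S) := by
  have hgap := hf.cost_sub_dualObjective hb lam K T t S (dualPoint lam K f (T - t) S)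
  have h1 := terminal_gap_nonneg hK (dualPoint_nonpos (lam := lam) (K := K) (f := f)
    (τ := T - t) (S := S)) (budget lam f b t S T)
  have h2 := hf.integral_loss_nonneg hlam htT (dualPoint lam K f (T - t) S) b
  have hbid : bidOf (dualPoint lam K f (T - t) S) = bidOf (costate lam K f (T - t) S) :=
    bidOf_min_zero _
  constructor
  · intro h
    have h0 : ∫ s in t..T, (hamiltonian lam f (dualPoint lam K f (T - t) S) -
        lam * bidGain f (dualPoint lam K f (T - t) S) (b s)) = 0 := by
      rw [h, dualValue, sub_self] at hgap
      linarith
    have hint : IntervalIntegrable (fun s => hamiltonian lam f (dualPoint lam K f (T - t) S) -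
        lam * bidGain f (dualPoint lam K f (T - t) S) (b s)) volume t T :=
      (continuous_const.sub (continuous_const.mul
        (hf.continuous_bidGain _))).intervalIntegrable_comp_bid hb t T
    rw [intervalIntegral.integral_of_le htT, ← integral_Icc_eq_integral_Ioc,
      setIntegral_eq_zero_iff_of_nonneg_ae (Eventually.of_forall fun s =>
        sub_nonneg.2 (hf.le_hamiltonian hlam _ _))
        ((intervalIntegrable_iff_integrableOn_Icc_of_le htT).1 hint)] at h0
    filter_upwards [h0] with s hs
    rw [← hbid]
    refine hf.eq_bidOf_of_bidGain_eq (mul_left_cancel₀ hlam.ne' ?_)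
    rw [← hf.hamiltonian_eq]
    exact (sub_eq_zero.1 hs).symm
  · intro h
    have hB := budget_of_ae_eq h (right_mem_Icc.2 htT)
    have hs := hf.costate_spec hlam hK (sub_nonneg.2 htT) S
    have hB' : budget lam f b t S T = costate lam K f (T - t) S / (2 * K) := by linarith
    have hI : ∫ s in t..T, (hamiltonian lam f (dualPoint lam K f (T - t) S) -
        lam * bidGain f (dualPoint lam K f (T - t) S) (b s)) = 0 := by
      rw [intervalIntegral.integral_of_le htT, ← integral_Icc_eq_integral_Ioc]
      refine integral_eq_zero_of_ae ?_
      filter_upwards [h] with s hs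
      rw [hs, ← hbid, ← hf.hamiltonian_eq, sub_self]; rfl
    have hT : K * min (budget lam f b t S T) 0 ^ 2 - dualPoint lam K f (T - t) S *
        budget lam f b t S T + dualPoint lam K f (T - t) S ^ 2 / (4 * K) = 0 := by
      rw [hB', dualPoint]
      rcases le_total (costate lam K f (T - t) S) 0 with hc | hc
      · rw [min_eq_left hc, min_eq_left (div_nonpos_of_nonpos_of_nonneg hc (by positivity))]
        field_simp; ring
      · rw [min_eq_right hc, min_eq_right (by positivity)]; ring
    rw [hI, hT] at hgap
    rw [dualValue]
    linarith

theorem IsPriceDensity.exists_cost_eq_dualValue (hf : IsPriceDensity f) (hlam : 0 < lam)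
    (hK : 0 < K) (htT : t ≤ T) (S : ℝ) :
    ∃ b : ℝ → ℝ≥0∞, Measurable b ∧ cost lam K T f t S b = dualValue lam K f (T - t) S :=
  ⟨fun _ => bidOf (costate lam K f (T - t) S), measurable_const,
    (hf.cost_eq_dualValue_iff hlam hK htT S measurable_const).2 (Eventually.of_forall fun _ => rfl)⟩

theorem IsPriceDensity.valueFn_eq (hf : IsPriceDensity f) (hlam : 0 < lam) (hK : 0 < K)
    (htT : t ≤ T) (S : ℝ) : valueFn lam K T f t S = dualValue lam K f (T - t) S := by
  obtain ⟨b, hb, hbc⟩ := hf.exists_cost_eq_dualValue hlam hK htT S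
  have hl : IsLeast (range fun b : {b : ℝ → ℝ≥0∞ // Measurable b} => cost lam K T f t S b.1)
      (dualValue lam K f (T - t) S) := by
    refine ⟨⟨⟨b, hb⟩, hbc⟩, ?_⟩
    rintro _ ⟨b', rfl⟩
    exact hf.dualValue_le_cost hlam hK htT S b'.2
  exact hl.csInf_eq

theorem IsPriceDensity.isOptimalControl_iff (hf : IsPriceDensity f) (hlam : 0 < lam) (hK : 0 < K)
    (htT : t ≤ T) (S : ℝ) (hb : Measurable b) :
    IsOptimalControl lam K T f t S b ↔
      ∀ᵐ s ∂(volume.restrict (Icc t T)), b s = bidOf (costate lam K f (T - t) S) := by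
  rw [← hf.cost_eq_dualValue_iff hlam hK htT S hb]
  constructor
  · intro h
    obtain ⟨b', hb', hc⟩ := hf.exists_cost_eq_dualValue hlam hK htT S
    exact le_antisymm ((h.2 b' hb').trans hc.le) (hf.dualValue_le_cost hlam hK htT S hb)
  · intro h
    exact ⟨hb, fun b' hb' => h.le.trans (hf.dualValue_le_cost hlam hK htT S hb')⟩

/-! ### The feedback form of the optimal control -/

/-- A primitive that vanishes at `t` and cannot increase where it is positive is nonpositive. -/
theorem integral_nonpos_of_nonpos_of_pos {d : ℝ → ℝ} (hd : IntervalIntegrable d volume t T)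
    (h : ∀ᵐ r ∂(volume.restrict (Icc t T)), 0 < ∫ u in t..r, d u → d r ≤ 0)
    {s : ℝ} (hs : s ∈ Icc t T) : ∫ u in t..s, d u ≤ 0 := by
  by_contra! hpos
  have htT : t ≤ T := hs.1.trans hs.2
  have hsub : ∀ {a c}, a ∈ Icc t T → c ∈ Icc t T → IntervalIntegrable d volume a c :=
    fun ha hc => hd.mono_set (uIcc_subset_uIcc (by rwa [uIcc_of_le htT]) (by rwa [uIcc_of_le htT]))
  have hcont : ContinuousOn (fun r => ∫ u in t..r, d u) (Icc t s) :=
    intervalIntegral.continuousOn_primitive_interval' (hsub (left_mem_Icc.2 htT) hs) left_mem_uIcc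
      |>.mono (by rw [uIcc_of_le hs.1])
  -- The last time before `s` at which the primitive is nonpositive.
  set A : Set ℝ := Icc t s ∩ (fun r => ∫ u in t..r, d u) ⁻¹' Iic 0 with hA
  have hAc : IsCompact A :=
    isCompact_Icc.of_isClosed_subset (hcont.preimage_isClosed_of_isClosed isClosed_Icc isClosed_Iic)
      inter_subset_left
  obtain ⟨a, ⟨ha1, ha2⟩, ha3⟩ := hAc.exists_isGreatest ⟨t, left_mem_Icc.2 hs.1, by simp⟩
  have ha2' : ∫ u in t..a, d u ≤ 0 := ha2
  have haT : a ∈ Icc t T := ⟨ha1.1, ha1.2.trans hs.2⟩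
  have hadd := intervalIntegral.integral_add_adjacent_intervals (hsub (left_mem_Icc.2 htT) haT)
    (hsub haT hs)
  have hle : ∫ u in a..s, d u ≤ 0 := by
    rw [intervalIntegral.integral_of_le ha1.2]
    refine integral_nonpos_of_ae ?_
    have h' := ae_restrict_of_ae_restrict_of_subset
      (show Ioc a s ⊆ Icc t T from fun r hr => ⟨ha1.1.trans hr.1.le, hr.2.trans hs.2⟩) h
    filter_upwards [h', ae_restrict_mem measurableSet_Ioc] with r hr hrm
    refine hr (not_le.1 fun hneg => ?_)
    exact absurd (ha3 ⟨⟨ha1.1.trans hrm.1.le, hrm.2⟩, hneg⟩) (not_le.2 hrm.1)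
  linarith

/-- The feedback bid `bidOf (costate (T - s) S)` is nondecreasing in the budget, so that budgets
driven by it from the same initial condition cannot separate. -/
theorem IsPriceDensity.ae_eq_feedback_iff (hf : IsPriceDensity f) (hlam : 0 < lam) (hK : 0 < K)
    (htT : t ≤ T) (S : ℝ) (hb : Measurable b) :
    (∀ᵐ s ∂(volume.restrict (Icc t T)), b s = bidOf (costate lam K f (T - t) S)) ↔
      ∀ᵐ s ∂(volume.restrict (Icc t T)),
        b s = bidOf (costate lam K f (T - s) (budget lam f b t S s)) := by
  set x := costate lam K f (T - t) S with hx
  have hspec := hf.costate_spec hlam hK (sub_nonneg.2 htT) S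
  rw [← hx] at hspec
  -- The costate is constant along the trajectory of the constant bid.
  have hconst : ∀ s ∈ Icc t T, x = costate lam K f (T - s) (S - (s - t) * spendRate lam f x) := by
    intro s hs
    refine hf.costate_unique hlam hK (sub_nonneg.2 hs.2) ?_
    linarith
  constructor
  · intro h
    filter_upwards [h, ae_restrict_mem measurableSet_Icc] with s hs hsm
    rw [hs, budget_of_ae_eq h hsm, ← hconst s hsm]
  · intro h
    have hG := hf.continuous_expectedPayment.intervalIntegrable_comp_bid hb t T
    have hd : IntervalIntegrable (fun r => spendRate lam f x - lam * expectedPayment f (b r))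
        volume t T := intervalIntegrable_const.sub (hG.const_mul lam)
    have hD : ∀ s ∈ Icc t T, ∫ r in t..s, (spendRate lam f x - lam * expectedPayment f (b r)) =
        budget lam f b t S s - (S - (s - t) * spendRate lam f x) := by
      intro s hs
      have hG' := hf.continuous_expectedPayment.intervalIntegrable_comp_bid hb t s
      rw [intervalIntegral.integral_sub intervalIntegrable_const (hG'.const_mul lam),
        intervalIntegral.integral_const, intervalIntegral.integral_const_mul, smul_eq_mul, budget]
      ring
    have hup : ∀ s ∈ Icc t T,
        ∫ r in t..s, (spendRate lam f x - lam * expectedPayment f (b r)) ≤ 0 :=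
      fun s hs => by
      refine integral_nonpos_of_nonpos_of_pos hd ?_ hs
      filter_upwards [h, ae_restrict_mem measurableSet_Icc] with r hr hrm hpos
      rw [hD r hrm, sub_pos] at hpos
      have hm := hf.monotone_costate hlam hK (sub_nonneg.2 hrm.2) hpos.le
      rw [← hconst r hrm] at hm
      rw [hr]
      exact sub_nonpos.2 (hf.monotone_spendRate hlam hm)
    have hlow : ∀ s ∈ Icc t T,
        ∫ r in t..s, -(spendRate lam f x - lam * expectedPayment f (b r)) ≤ 0 := fun s hs => by
      refine integral_nonpos_of_nonpos_of_pos hd.neg ?_ hs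
      filter_upwards [h, ae_restrict_mem measurableSet_Icc] with r hr hrm hpos
      simp only [Pi.neg_apply] at hpos ⊢
      rw [intervalIntegral.integral_neg, hD r hrm, neg_pos, sub_neg] at hpos
      have hm := hf.monotone_costate hlam hK (sub_nonneg.2 hrm.2) hpos.le
      rw [← hconst r hrm] at hm
      rw [hr, neg_sub]
      exact sub_nonpos.2 (hf.monotone_spendRate hlam hm)
    filter_upwards [h, ae_restrict_mem measurableSet_Icc] with s hs hsm
    have h1 := hup s hsm
    have h2 := hlow s hsm
    rw [intervalIntegral.integral_neg] at h2
    rw [hD s hsm] at h1 h2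
    have h3 : budget lam f b t S s = S - (s - t) * spendRate lam f x := by linarith
    rw [hs, h3, ← hconst s hsm]

theorem IsPriceDensity.isOptimalControlFunction (hf : IsPriceDensity f) (hlam : 0 < lam)
    (hK : 0 < K) :
    IsOptimalControlFunction lam K T f fun t S => bidOf (costate lam K f (T - t) S) := by
  intro t ht S
  refine ⟨⟨fun _ => bidOf (costate lam K f (T - t) S), ?_⟩, fun b hb => ?_⟩
  · exact (hf.isOptimalControl_iff hlam hK ht.2 S measurable_const).2
      (Eventually.of_forall fun _ => rfl)
  · rw [hf.isOptimalControl_iff hlam hK ht.2 S hb, hf.ae_eq_feedback_iff hlam hK ht.2 S hb]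

/-! ### The value function is a weak semi-concave solution -/

theorem IsPriceDensity.isWeakSemiconcaveSolution_valueFn (hf : IsPriceDensity f) (hlam : 0 < lam)
    (hK : 0 < K) : IsWeakSemiconcaveSolution lam K T f (valueFn lam K T f) where
  locallyLipschitz := by
    have hg : LipschitzWith 1 fun z : ℝ × ℝ => (T - z.1, z.2) := by
      refine LipschitzWith.of_dist_le_mul fun y z => ?_
      rw [NNReal.coe_one, one_mul, Prod.dist_eq, Prod.dist_eq, dist_sub_left]
    intro z hz
    obtain ⟨C, U, hU, hC⟩ := hf.locallyLipschitzOn_dualValue hlam hK (x := (T - z.1, z.2))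
      ⟨sub_nonneg.2 hz.1.2, mem_univ _⟩
    have hmaps : Tendsto (fun z : ℝ × ℝ => (T - z.1, z.2)) (𝓝[Icc 0 T ×ˢ univ] z)
        (𝓝[Ici 0 ×ˢ univ] (T - z.1, z.2)) :=
      hg.continuous.continuousWithinAt.tendsto_nhdsWithin
        fun y hy => ⟨sub_nonneg.2 hy.1.2, mem_univ _⟩
    refine ⟨C * 1, _, Filter.inter_mem (hmaps hU) self_mem_nhdsWithin, ?_⟩
    have hL := hC.comp (hg.lipschitzOnWith (s := (fun z : ℝ × ℝ => (T - z.1, z.2)) ⁻¹' U))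
      (mapsTo_preimage _ _)
    intro y hy w hw
    simp only [hf.valueFn_eq hlam hK hy.2.1.2, hf.valueFn_eq hlam hK hw.2.1.2]
    exact hL hy.1 hw.1
  terminal S := by
    rw [hf.valueFn_eq hlam hK le_rfl, sub_self, hf.dualValue_zero hlam hK]
  equation := by
    filter_upwards [ae_restrict_mem (measurableSet_Ioo.prod MeasurableSet.univ)] with z hz
    have hz1 : 0 < T - z.1 := sub_pos.2 hz.1.2
    refine ⟨hamiltonian lam f (dualPoint lam K f (T - z.1) z.2),
      dualPoint lam K f (T - z.1) z.2, ?_, ?_, ?_⟩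
    · have h := (hf.hasDerivAt_dualValue_time hlam hK hz1 z.2).scomp z.1
        ((hasDerivAt_id z.1).const_sub T)
      refine (h.congr_deriv (by simp)).congr_of_eventuallyEq ?_
      filter_upwards [gt_mem_nhds hz.1.2] with r hr
      exact hf.valueFn_eq hlam hK hr.le _
    · refine (hf.hasDerivAt_dualValue_budget hlam hK hz1.le z.2).congr_of_eventuallyEq
        (Eventually.of_forall fun y => ?_)
      exact hf.valueFn_eq hlam hK hz.1.2.le _
    · simp only [hf.hamiltonian_eq_neg_iInf, neg_neg, mul_comm (dualPoint _ _ _ _ _), sub_self]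
  semiconcave := by
    refine ⟨4 * K, by positivity, fun t ht S z => ?_⟩
    simp only [hf.valueFn_eq hlam hK ht.2.le]
    have hτ : 0 < T - t := sub_pos.2 ht.2
    refine (hf.dualValue_semiconcave hlam hK hτ.le S z).trans ?_
    have h1 : 0 ≤ 1 / (T - t) := by positivity
    have h2 : 0 ≤ 4 * K * z ^ 2 := by positivity
    nlinarith

end

/-! ### Almost everywhere inequalities for locally Lipschitz functions -/

/-- A bound on the time derivative almost everywhere in a strip can be integrated along every
vertical segment of the strip: by Fubini along almost every one, and then by continuity. -/
theorem sub_le_of_ae_hasDerivAt_le {w : ℝ → ℝ → ℝ} {t₁ t₂ a b c : ℝ} (h12 : t₁ ≤ t₂)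
    (hw : LocallyLipschitzOn (Icc t₁ t₂ ×ˢ univ) (fun z : ℝ × ℝ => w z.1 z.2))
    (hae : ∀ᵐ z ∂(volume.restrict (Ioo t₁ t₂ ×ˢ Ioo a b) : Measure (ℝ × ℝ)),
      ∃ d ≤ c, HasDerivAt (fun r => w r z.2) d z.1)
    {y : ℝ} (hy : y ∈ Ioo a b) : w t₂ y - w t₁ y ≤ c * (t₂ - t₁) := by
  have hcont : ∀ t ∈ Icc t₁ t₂, Continuous fun y => w t y := fun t ht =>
    hw.continuousOn.comp_continuous (f := fun y => (t, y)) (by fun_prop) fun y => ⟨ht, mem_univ _⟩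
  have hgood : ∀ᵐ y ∂(volume : Measure ℝ), y ∈ Ioo a b → w t₂ y - w t₁ y ≤ c * (t₂ - t₁) := by
    rw [Measure.volume_eq_prod, ← Measure.prod_restrict] at hae
    have hsw := Measure.ae_ae_of_ae_prod
      ((Measure.measurePreserving_swap (μ := volume.restrict (Ioo a b))
        (ν := volume.restrict (Ioo t₁ t₂))).quasiMeasurePreserving.ae hae)
    rw [← ae_restrict_iff' measurableSet_Ioo]
    filter_upwards [hsw] with y hy
    obtain ⟨C, hC⟩ := (hw.mono (prod_mono_right (subset_univ {y}))
      ).exists_lipschitzOnWith_of_compact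
      (isCompact_Icc.prod isCompact_singleton)
    have hCy : LipschitzOnWith C (fun r => w r y) (uIcc t₁ t₂) := by
      rw [uIcc_of_le h12]
      intro r hr s hs
      have h := hC (x := (r, y)) ⟨hr, rfl⟩ (y := (s, y)) ⟨hs, rfl⟩
      simpa [Prod.edist_eq] using h
    have hac := hCy.absolutelyContinuousOnInterval
    rw [← hac.integral_deriv_eq_sub]
    refine (intervalIntegral.integral_mono_ae_restrict (g := fun _ => c) h12
      hac.intervalIntegrable_deriv intervalIntegrable_const ?_).trans ?_
    · rw [← restrict_Ioo_eq_restrict_Icc]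
      filter_upwards [hy] with r hr
      obtain ⟨d, hd, hdr⟩ := hr
      have : deriv (fun r => w r y) r = d := hdr.deriv
      rwa [this]
    · rw [intervalIntegral.integral_const, smul_eq_mul, mul_comm]
  by_contra! hlt
  have hopen : IsOpen (Ioo a b ∩ {y | c * (t₂ - t₁) < w t₂ y - w t₁ y}) :=
    isOpen_Ioo.inter (isOpen_lt continuous_const
      ((hcont t₂ (right_mem_Icc.2 h12)).sub (hcont t₁ (left_mem_Icc.2 h12))))
  obtain ⟨y', ⟨hy1, hy2⟩, hy3⟩ := (Measure.dense_of_ae hgood).inter_open_nonempty _ hopen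
    ⟨y, hy, hlt⟩
  exact absurd (hy3 hy1) (not_le.2 hy2)

/-- Rademacher's theorem on a strip. -/
theorem ae_differentiableAt_of_locallyLipschitzOn_strip {w : ℝ × ℝ → ℝ} {T : ℝ}
    (hw : LocallyLipschitzOn (Icc 0 T ×ˢ univ) w) :
    ∀ᵐ z ∂(volume : Measure (ℝ × ℝ)), z ∈ Ioo 0 T ×ˢ (univ : Set ℝ) → DifferentiableAt ℝ w z := by
  have h : ∀ n : ℕ, ∀ᵐ z ∂(volume : Measure (ℝ × ℝ)), z ∈ Icc 0 T ×ˢ Icc (-(n : ℝ)) n →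
      DifferentiableWithinAt ℝ w (Icc 0 T ×ˢ Icc (-(n : ℝ)) n) z := by
    intro n
    obtain ⟨C, hC⟩ := (hw.mono (prod_mono_right (subset_univ (Icc (-(n : ℝ)) n)))
      ).exists_lipschitzOnWith_of_compact (isCompact_Icc.prod isCompact_Icc)
    exact hC.ae_differentiableWithinAt_of_mem
  filter_upwards [ae_all_iff.2 h] with z hz hzT
  obtain ⟨n, hn⟩ := exists_nat_gt |z.2|
  have hn' := abs_lt.1 hn
  have hmem : Icc 0 T ×ˢ Icc (-(n : ℝ)) n ∈ 𝓝 z :=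
    prod_mem_nhds (Icc_mem_nhds hzT.1.1 hzT.1.2) (Icc_mem_nhds hn'.1 hn'.2)
  exact (hz n (mem_of_mem_nhds hmem)).differentiableAt hmem

/-- Midpoint semi-concavity gives the one-sided second order bound at points of
differentiability. -/
theorem mul_le_of_hasDerivAt_of_semiconcave {g : ℝ → ℝ} {p S C ρ : ℝ} (hg : HasDerivAt g p S)
    (hC : 0 ≤ C) (hsc : ∀ y z, g (y + z) - 2 * g y + g (y - z) ≤ C * z ^ 2) (hρ : 0 < ρ) :
    p * ρ ≤ g S - g (S - ρ) + C * ρ ^ 2 := by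
  -- Halve the step repeatedly: the difference quotients over `ρ / 2 ^ n` tend to the derivative.
  have hstep : ∀ n : ℕ, g (S - ρ) - g S ≤ 2 ^ n * (g (S + (-ρ) * (1 / 2) ^ n) - g S) +
      C * ρ ^ 2 * (1 - (1 / 2) ^ n) / 2 := by
    intro n
    induction n with
    | zero => simp [sub_eq_add_neg]
    | succ n ih =>
      have h := hsc (S + (-ρ) * (1 / 2) ^ (n + 1)) (ρ * (1 / 2) ^ (n + 1))
      rw [show S + -ρ * (1 / 2) ^ (n + 1) + ρ * (1 / 2) ^ (n + 1) = S by ring,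
        show S + -ρ * (1 / 2) ^ (n + 1) - ρ * (1 / 2) ^ (n + 1) = S + -ρ * (1 / 2) ^ n by ring] at h
      have h2 := mul_le_mul_of_nonneg_left h (show (0 : ℝ) ≤ 2 ^ n by positivity)
      have h3 : (2 : ℝ) ^ n * (1 / 2) ^ n = 1 := by rw [← mul_pow]; norm_num
      have h4 : (2 : ℝ) ^ n * (C * (ρ * (1 / 2) ^ (n + 1)) ^ 2) =
          C * ρ ^ 2 * (1 / 2) ^ n / 4 := by
        linear_combination (C * ρ ^ 2 * (1 / 2) ^ n / 4) * h3
      rw [h4] at h2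
      have h5 : C * ρ ^ 2 * (1 - (1 / 2 : ℝ) ^ (n + 1)) / 2 =
        C * ρ ^ 2 * (1 - (1 / 2) ^ n) / 2 + C * ρ ^ 2 * (1 / 2) ^ n / 4 := by ring
      rw [h5, pow_succ (2 : ℝ)]
      linarith
  have hlim : Tendsto (fun n : ℕ => (2 : ℝ) ^ n * (g (S + (-ρ) * (1 / 2) ^ n) - g S)) atTop
      (𝓝 (-ρ * p)) := by
    have ht : Tendsto (fun n : ℕ => (-ρ) * (1 / 2 : ℝ) ^ n) atTop (𝓝[≠] 0) := by
      refine tendsto_nhdsWithin_iff.2 ⟨?_, Eventually.of_forall fun n => ?_⟩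
      · simpa using (tendsto_pow_atTop_nhds_zero_of_lt_one (by norm_num : (0 : ℝ) ≤ 1 / 2)
          (by norm_num)).const_mul (-ρ)
      · exact mul_ne_zero (neg_ne_zero.2 hρ.ne') (by positivity)
    have h := ((hasDerivAt_iff_tendsto_slope_zero.1 hg).comp ht).const_mul (-ρ)
    refine h.congr fun n => ?_
    simp only [Function.comp, smul_eq_mul, mul_inv, one_div, inv_pow, inv_inv]
    field_simp
  have hle : g (S - ρ) - g S - C * ρ ^ 2 ≤ -ρ * p := by
    refine ge_of_tendsto' hlim fun n => ?_
    have h1 := hstep n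
    have h2 : 0 ≤ C * ρ ^ 2 := by positivity
    have h3 : (0 : ℝ) ≤ (1 / 2) ^ n := by positivity
    nlinarith [mul_nonneg h2 h3]
  linarith

/-! ### Uniqueness of the weak semi-concave solution -/

section

variable {f : ℝ → ℝ} {lam K T : ℝ} {u : ℝ → ℝ → ℝ}

theorem IsWeakSemiconcaveSolution.ae_hasDerivAt (hu : IsWeakSemiconcaveSolution lam K T f u)
    (hf : IsPriceDensity f) :
    ∀ᵐ z ∂(volume : Measure (ℝ × ℝ)), z ∈ Ioo 0 T ×ˢ (univ : Set ℝ) → ∃ p : ℝ,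
      HasDerivAt (fun r => u r z.2) (hamiltonian lam f p) z.1 ∧
      HasDerivAt (fun y => u z.1 y) p z.2 := by
  rw [← ae_restrict_iff' (measurableSet_Ioo.prod MeasurableSet.univ)]
  filter_upwards [hu.equation] with z ⟨vt, vS, h1, h2, h3⟩
  refine ⟨vS, ?_, h2⟩
  rw [hf.hamiltonian_eq_neg_iInf, show -(lam * ⨅ b : ℝ≥0, -∫ p in (0 : ℝ)..(b : ℝ),
    f p * (1 + vS * p)) = vt by simp only [mul_comm vS]; linarith]
  exact h1

/-- Along the line followed under a constant bid, the equation bounds the growth of a solution from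
below. -/
theorem IsWeakSemiconcaveSolution.le_of_constant_bid (hu : IsWeakSemiconcaveSolution lam K T f u)
    (hf : IsPriceDensity f) (hlam : 0 < lam) {t : ℝ} (ht : t ∈ Icc 0 T) (S : ℝ) (b : ℝ≥0∞) :
    u t S ≤ -(lam * priceCDF f b) * (T - t) +
      u T (S - lam * expectedPayment f b * (T - t)) := by
  set q := lam * expectedPayment f b with hq
  have hshear : ContDiff ℝ 1 fun z : ℝ × ℝ => (z.1, z.2 - q * z.1) := by fun_prop
  have hLip : LocallyLipschitzOn (Icc t T ×ˢ univ)
      (fun z : ℝ × ℝ => -u z.1 (z.2 - q * z.1)) := by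
    intro z hz
    obtain ⟨C, U, hU, hC⟩ := hu.locallyLipschitz (x := (z.1, z.2 - q * z.1))
      ⟨⟨ht.1.trans hz.1.1, hz.1.2⟩, mem_univ _⟩
    obtain ⟨C', U', hU', hC'⟩ := hshear.locallyLipschitz z
    have hmaps : Tendsto (fun z : ℝ × ℝ => (z.1, z.2 - q * z.1)) (𝓝[Icc t T ×ˢ univ] z)
        (𝓝[Icc 0 T ×ˢ univ] (z.1, z.2 - q * z.1)) :=
      hshear.continuous.continuousWithinAt.tendsto_nhdsWithin
        fun y hy => ⟨⟨ht.1.trans hy.1.1, hy.1.2⟩, mem_univ _⟩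
    refine ⟨C * C', _, Filter.inter_mem (hmaps hU) (mem_nhdsWithin_of_mem_nhds hU'), ?_⟩
    intro y hy w hw
    have h := hC.comp (hC'.mono inter_subset_right) (fun y hy => hy.1) hy hw
    rwa [← edist_neg_neg] at h
  have hae : ∀ᵐ z ∂(volume : Measure (ℝ × ℝ)), z ∈ Ioo t T ×ˢ (univ : Set ℝ) →
      ∃ d ≤ -(lam * priceCDF f b), HasDerivAt (fun r => -u r (z.2 - q * r)) d z.1 := by
    have hmp : MeasurePreserving (fun z : ℝ × ℝ => (z.1, z.2 - q * z.1)) :=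
      (MeasurePreserving.id volume).skew_product (g := fun r y => y - q * r) (by fun_prop)
        (Eventually.of_forall fun r => (measurePreserving_sub_right volume (q * r)).map_eq)
    have h1 := hmp.quasiMeasurePreserving.ae (hu.ae_hasDerivAt hf)
    have h2 := hmp.quasiMeasurePreserving.ae
      (ae_differentiableAt_of_locallyLipschitzOn_strip hu.locallyLipschitz)
    filter_upwards [h1, h2] with z hz1 hz2 hz
    have hz0 : (z.1, z.2 - q * z.1) ∈ Ioo 0 T ×ˢ (univ : Set ℝ) :=
      ⟨⟨ht.1.trans_lt hz.1.1, hz.1.2⟩, mem_univ _⟩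
    obtain ⟨p, hp1, hp2⟩ := hz1 hz0
    have hD := (hz2 hz0).hasFDerivAt
    set D := fderiv ℝ (fun z : ℝ × ℝ => u z.1 z.2) (z.1, z.2 - q * z.1) with hDdef
    have e1 : D (1, 0) = hamiltonian lam f p := by
      have h := hD.comp_hasDerivAt z.1
        (f := fun r : ℝ => (r, z.2 - q * z.1))
        ((hasDerivAt_id z.1).prodMk (hasDerivAt_const z.1 (z.2 - q * z.1)))
      exact h.unique hp1
    have e2 : D (0, 1) = p := by
      have h := hD.comp_hasDerivAt (z.2 - q * z.1) (f := fun y : ℝ => (z.1, y))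
        ((hasDerivAt_const _ z.1).prodMk (hasDerivAt_id _))
      exact h.unique hp2
    have h3 := hD.comp_hasDerivAt z.1 (f := fun r : ℝ => (r, z.2 - q * r))
      ((hasDerivAt_id z.1).prodMk (((hasDerivAt_id z.1).const_mul q).const_sub z.2))
    refine ⟨_, ?_, h3.neg⟩
    have e3 : D (1, -(q * 1)) = hamiltonian lam f p - q * p := by
      have : ((1 : ℝ), -(q * 1)) = (1, 0) + (-q) • ((0 : ℝ), (1 : ℝ)) := by
        ext <;> simp
      rw [this, map_add, map_smul, e1, e2, smul_eq_mul]; ring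
    rw [e3]
    have h4 := hf.le_hamiltonian hlam p b
    rw [bidGain] at h4
    rw [hq]
    linarith
  have hae' : ∀ᵐ z ∂(volume.restrict (Ioo t T ×ˢ Ioo (S + q * t - 1) (S + q * t + 1)) :
      Measure (ℝ × ℝ)), ∃ d ≤ -(lam * priceCDF f b),
      HasDerivAt (fun r => -u r (z.2 - q * r)) d z.1 := by
    rw [ae_restrict_iff' (measurableSet_Ioo.prod measurableSet_Ioo)]
    filter_upwards [hae] with z hz hzm using hz ⟨hzm.1, mem_univ _⟩
  have h := sub_le_of_ae_hasDerivAt_le (w := fun r y => -u r (y - q * r)) ht.2 hLip hae'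
    (y := S + q * t) ⟨by linarith, by linarith⟩
  simp only [add_sub_cancel_right] at h
  rw [show S + q * t - q * T = S - q * (T - t) by ring] at h
  linarith

theorem IsWeakSemiconcaveSolution.le_dualValue (hu : IsWeakSemiconcaveSolution lam K T f u)
    (hf : IsPriceDensity f) (hlam : 0 < lam) (hK : 0 < K) {t : ℝ} (ht : t ∈ Icc 0 T) (S : ℝ) :
    u t S ≤ dualValue lam K f (T - t) S := by
  have h1 := hu.le_of_constant_bid hf hlam ht S (bidOf (costate lam K f (T - t) S))
  have h2 := (hf.cost_eq_dualValue_iff hlam hK ht.2 S (measurable_const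
    (a := bidOf (costate lam K f (T - t) S)))).2 (Eventually.of_forall fun _ => rfl)
  rw [hu.terminal] at h1
  refine h1.trans (le_of_eq (Eq.trans ?_ h2))
  rw [cost, budget, intervalIntegral.integral_const, intervalIntegral.integral_const, smul_eq_mul,
    smul_eq_mul, show lam * ((T - t) * expectedPayment f (bidOf (costate lam K f (T - t) S))) =
      lam * expectedPayment f (bidOf (costate lam K f (T - t) S)) * (T - t) by ring]
  ring

/-- Supersolution property. Where a function with derivative `p` touches a semi-concave solution
from below in the budget variable, semi-concavity makes the budget derivatives at nearby points
almost at most `p`, so that the solution grows in time at most at rate about `H(p)`. -/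
theorem IsWeakSemiconcaveSolution.eventually_sub_le (hu : IsWeakSemiconcaveSolution lam K T f u)
    (hf : IsPriceDensity f) (hlam : 0 < lam) {t S p c : ℝ} (ht : t ∈ Ico 0 T) {φ : ℝ → ℝ}
    (hφ : HasDerivAt φ p S) (hmin : ∀ᶠ y in 𝓝 S, u t S - φ S ≤ u t y - φ y)
    (hc : hamiltonian lam f p < c) :
    ∀ᶠ h in 𝓝[>] (0 : ℝ), u (t + h) S - u t S ≤ c * h := by
  obtain ⟨ε, hε, hεc⟩ : ∃ ε > 0, hamiltonian lam f (p + 3 * ε) < c := by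
    have hcont : ContinuousAt (fun ε : ℝ => hamiltonian lam f (p + 3 * ε)) 0 := by
      have h := (hf.hasDerivAt_hamiltonian hlam (p + 3 * 0)).continuousAt
      exact ContinuousAt.comp (f := fun ε : ℝ => p + 3 * ε) h (by fun_prop)
    have hev : ∀ᶠ ε in 𝓝[>] (0 : ℝ), hamiltonian lam f (p + 3 * ε) < c :=
      (hcont.eventually (gt_mem_nhds (by simpa using hc))).filter_mono nhdsWithin_le_nhds
    obtain ⟨ε, h1, h2⟩ := (eventually_mem_nhdsWithin (s := Ioi (0 : ℝ))).and hev |>.exists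
    exact ⟨ε, h1, h2⟩
  obtain ⟨C, hC, hsc⟩ := hu.semiconcave
  -- Up to the time halfway to `T` the semi-concavity constant is uniformly bounded.
  have hTt : 0 < T - t := sub_pos.2 ht.2
  set C' := C * (1 + 1 / ((T - t) / 2)) with hC'def
  have hC' : 0 ≤ C' := by positivity
  have hsc' : ∀ r ∈ Icc t (t + (T - t) / 2), ∀ y z : ℝ,
      u r (y + z) - 2 * u r y + u r (y - z) ≤ C' * z ^ 2 := by
    intro r hr y z
    have h1 : (T - t) / 2 ≤ T - r := by linarith [hr.2]
    refine (hsc r ⟨ht.1.trans hr.1, by linarith⟩ y z).trans ?_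
    rw [hC'def]
    gcongr
  obtain ⟨ρ, hρ0, hρ1, hρ2, hρ3⟩ : ∃ ρ > 0, φ S - φ (S - ρ) ≤ (p + ε) * ρ ∧
      u t S - φ S ≤ u t (S - ρ) - φ (S - ρ) ∧ C' * ρ ≤ ε := by
    have hsubt : Tendsto (fun ρ : ℝ => S - ρ) (𝓝[>] 0) (𝓝 S) :=
      tendsto_nhdsWithin_of_tendsto_nhds (Continuous.tendsto' (by fun_prop) _ _ (by simp))
    have h1 : ∀ᶠ ρ in 𝓝[>] (0 : ℝ), φ S - φ (S - ρ) ≤ (p + ε) * ρ := by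
      have h := hsubt.eventually ((hasDerivAt_iff_isLittleO.1 hφ).bound hε)
      filter_upwards [h, self_mem_nhdsWithin] with ρ hρ hρ0
      have hρ0' : (0 : ℝ) < ρ := hρ0
      rw [sub_sub_cancel_left, norm_neg, Real.norm_of_nonneg hρ0'.le, Real.norm_eq_abs,
        smul_eq_mul] at hρ
      have := (abs_le.1 hρ).1
      linarith
    have h2 := hsubt.eventually hmin
    have h3 : ∀ᶠ ρ in 𝓝[>] (0 : ℝ), C' * ρ ≤ ε := by
      have hcont : ContinuousAt (fun ρ : ℝ => C' * ρ) 0 := by fun_prop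
      filter_upwards [(hcont.eventually (gt_mem_nhds (show C' * 0 < ε by simpa using hε))
        ).filter_mono
        nhdsWithin_le_nhds] with ρ hρ using le_of_lt hρ
    obtain ⟨ρ, h0, h1, h2, h3⟩ := ((eventually_mem_nhdsWithin (s := Ioi (0 : ℝ))).and
      (h1.and (h2.and h3))).exists
    exact ⟨ρ, h0, h1, h2, h3⟩
  obtain ⟨r, hr0, hr⟩ : ∃ r > 0, ∀ z ∈ Icc 0 T ×ˢ (univ : Set ℝ), dist z (t, S) < r →
      u z.1 z.2 - u z.1 (z.2 - ρ) < (p + 2 * ε) * ρ := by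
    have hcu := hu.locallyLipschitz.continuousOn
    have hcu' : ContinuousOn (fun z : ℝ × ℝ => u z.1 (z.2 - ρ)) (Icc 0 T ×ˢ univ) :=
      hcu.comp (f := fun z : ℝ × ℝ => (z.1, z.2 - ρ)) (by fun_prop)
        fun z hz => ⟨hz.1, mem_univ _⟩
    have hlt : u t S - u t (S - ρ) < (p + 2 * ε) * ρ := by nlinarith
    have hev := ((hcu.sub hcu') (t, S) ⟨Ico_subset_Icc_self ht, mem_univ _⟩).eventually
      (gt_mem_nhds hlt)
    obtain ⟨r, hr0, hr⟩ := Metric.mem_nhdsWithin_iff.1 hev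
    exact ⟨r, hr0, fun z hz hzr => hr ⟨hzr, hz⟩⟩
  have hsmall : ∀ᶠ h in 𝓝[>] (0 : ℝ), h < min r ((T - t) / 2) :=
    (gt_mem_nhds (lt_min hr0 (half_pos hTt))).filter_mono nhdsWithin_le_nhds
  filter_upwards [hsmall, self_mem_nhdsWithin] with h hh hh0
  have hh0' : (0 : ℝ) < h := hh0
  obtain ⟨hhr, hhT⟩ := lt_min_iff.1 hh
  have hsub : Icc t (t + h) ⊆ Icc 0 T := Icc_subset_Icc ht.1 (by linarith)
  have hae : ∀ᵐ z ∂(volume.restrict (Ioo t (t + h) ×ˢ Ioo (S - r) (S + r)) : Measure (ℝ × ℝ)),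
      ∃ d ≤ c, HasDerivAt (fun r => u r z.2) d z.1 := by
    rw [ae_restrict_iff' (measurableSet_Ioo.prod measurableSet_Ioo)]
    filter_upwards [hu.ae_hasDerivAt hf] with z hz hzm
    obtain ⟨q, hq1, hq2⟩ := hz ⟨⟨ht.1.trans_lt hzm.1.1, by linarith [hzm.1.2]⟩, mem_univ _⟩
    refine ⟨_, ?_, hq1⟩
    have h1 := mul_le_of_hasDerivAt_of_semiconcave hq2 hC'
      (hsc' z.1 ⟨hzm.1.1.le, by linarith [hzm.1.2]⟩) hρ0
    have h2 := hr z ⟨hsub ⟨hzm.1.1.le, hzm.1.2.le⟩, mem_univ _⟩ (by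
      rw [Prod.dist_eq, max_lt_iff, Real.dist_eq, Real.dist_eq, abs_lt, abs_lt]
      obtain ⟨⟨a1, a2⟩, a3, a4⟩ := hzm
      refine ⟨⟨?_, ?_⟩, ?_, ?_⟩ <;> simp only <;> linarith)
    have h3 : q * ρ ≤ (p + 3 * ε) * ρ := by nlinarith
    exact (hf.monotone_hamiltonian hlam (le_of_mul_le_mul_right h3 hρ0)).trans hεc.le
  have hfin := sub_le_of_ae_hasDerivAt_le (by linarith)
    (hu.locallyLipschitz.mono (prod_mono_left hsub)) hae
    (y := S) ⟨by linarith, by linarith⟩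
  rwa [add_sub_cancel_left] at hfin

/-- Comparison from below. Characteristics move down at a speed between `0` and
`M = λ ∫ p f(p) dp`. The difference with the dual value, penalised outside the domain of dependence
`S₀ - M (t - t₀) ≤ S ≤ S₀`, cannot have a negative minimum, because the penalty does not increase
along characteristics. -/
theorem IsWeakSemiconcaveSolution.dualValue_le (hu : IsWeakSemiconcaveSolution lam K T f u)
    (hf : IsPriceDensity f) (hlam : 0 < lam) (hK : 0 < K) {t₀ : ℝ} (ht₀ : t₀ ∈ Icc 0 T) (S₀ : ℝ) :
    dualValue lam K f (T - t₀) S₀ ≤ u t₀ S₀ := by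
  set M := lam * meanPrice f with hM
  have hM0 : 0 ≤ M := mul_nonneg hlam.le hf.meanPrice_nonneg
  set R := 1 + M * (T - t₀) with hR
  have hR1 : 1 ≤ R := by have := mul_nonneg hM0 (sub_nonneg.2 ht₀.2); linarith
  set Q : Set (ℝ × ℝ) := Icc t₀ T ×ˢ Icc (S₀ - R) (S₀ + R) with hQ
  have hQc : IsCompact Q := isCompact_Icc.prod isCompact_Icc
  have hQsub : Q ⊆ Icc 0 T ×ˢ univ := prod_mono (Icc_subset_Icc_left ht₀.1) (subset_univ _)
  have hcw : ContinuousOn (fun z : ℝ × ℝ => u z.1 z.2 - dualValue lam K f (T - z.1) z.2) Q := by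
    refine (hu.locallyLipschitz.continuousOn.mono hQsub).sub ?_
    exact (hf.locallyLipschitzOn_dualValue hlam hK).continuousOn.comp
      (f := fun z : ℝ × ℝ => (T - z.1, z.2)) (by fun_prop)
      fun z hz => ⟨sub_nonneg.2 hz.1.2, mem_univ _⟩
  obtain ⟨A, hA⟩ := hQc.exists_bound_of_continuousOn hcw
  have h0Q : (t₀, S₀) ∈ Q := ⟨left_mem_Icc.2 ht₀.2, by linarith, by linarith⟩
  have hA0 : 0 ≤ A := (norm_nonneg _).trans (hA _ h0Q)
  refine le_of_forall_pos_le_add fun ε hε => ?_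
  -- `ε` is rescaled so that the slope `ε / (T + 1)` in time costs at most `ε`.
  set e := ε / (T + 1) with he
  have hT0 : 0 ≤ T := ht₀.1.trans ht₀.2
  have he0 : 0 < e := by positivity
  set Φ : ℝ × ℝ → ℝ := fun z => u z.1 z.2 - dualValue lam K f (T - z.1) z.2 +
    A * (max (z.2 - S₀) 0 ^ 2 + max (S₀ - z.2 - M * (z.1 - t₀)) 0 ^ 2) + e * (T - z.1) with hΦ
  have hcΦ : ContinuousOn Φ Q := (hcw.add (Continuous.continuousOn (by fun_prop))).add
    (Continuous.continuousOn (by fun_prop))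
  obtain ⟨⟨t, S⟩, hzQ, hzmin⟩ := hQc.exists_isMinOn ⟨_, h0Q⟩ hcΦ
  have hmin : ∀ z ∈ Q, Φ (t, S) ≤ Φ z := fun z hz => hzmin hz
  suffices hpos : 0 ≤ Φ (t, S) by
    have h := hpos.trans (hmin _ h0Q)
    simp only [hΦ, sub_self, mul_zero, max_self] at h
    have h1 : e * (T - t₀) ≤ ε := by
      rw [he, div_mul_eq_mul_div, div_le_iff₀ (by positivity)]
      nlinarith [ht₀.1]
    nlinarith
  by_contra! hneg
  obtain ⟨⟨ht1, ht2⟩, hS1, hS2⟩ := hzQ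
  simp only at ht1 ht2 hS1 hS2
  have hbound := abs_le.1 (hA (t, S) ⟨⟨ht1, ht2⟩, hS1, hS2⟩)
  simp only at hbound
  have heT : 0 ≤ e * (T - t) := mul_nonneg he0.le (sub_nonneg.2 ht2)
  have hMt : M * (t - t₀) ≤ M * (T - t₀) := mul_le_mul_of_nonneg_left (by linarith) hM0
  -- The penalty dominates on the lateral boundary, and the terminal values agree.
  have htT : t < T := by
    refine lt_of_le_of_ne ht2 fun h => ?_
    simp only [hΦ] at hneg
    rw [h, hu.terminal, sub_self T, hf.dualValue_zero hlam hK, sub_self, zero_add, mul_zero,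
      add_zero] at hneg
    exact absurd hneg (not_lt.2 (by positivity))
  have hlat : ∀ x y : ℝ, 1 ≤ x ∨ 1 ≤ y → A ≤ A * (max x 0 ^ 2 + max y 0 ^ 2) := by
    intro x y hxy
    refine le_mul_of_one_le_right hA0 ?_
    rcases hxy with h | h
    · have := le_max_left x 0; nlinarith [sq_nonneg (max y 0)]
    · have := le_max_left y 0; nlinarith [sq_nonneg (max x 0)]
  have hSR : S < S₀ + R := by
    refine lt_of_le_of_ne hS2 fun h => ?_
    have := hlat (S - S₀) (S₀ - S - M * (t - t₀)) (Or.inl (by linarith))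
    simp only [hΦ] at hneg
    linarith [hbound.1]
  have hSL : S₀ - R < S := by
    refine lt_of_le_of_ne hS1 fun h => ?_
    have := hlat (S - S₀) (S₀ - S - M * (t - t₀)) (Or.inr (by linarith))
    simp only [hΦ] at hneg
    linarith [hbound.1]
  have hτ : 0 ≤ T - t := sub_nonneg.2 ht2
  set ξ := dualPoint lam K f (T - t) S with hξ
  set Y := S₀ - S - M * (t - t₀) with hY
  set φ : ℝ → ℝ := fun y => dualValue lam K f (T - t) y -
    A * (max (y - S₀) 0 ^ 2 + max (S₀ - y - M * (t - t₀)) 0 ^ 2) with hφdef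
  have hφ : HasDerivAt φ (ξ - A * (2 * max (S - S₀) 0 + 2 * max Y 0 * -1)) S := by
    have h1 : HasDerivAt (fun y : ℝ => max (y - S₀) 0 ^ 2) (2 * max (S - S₀) 0) S := by
      exact ((hasDerivAt_max_zero_sq (S - S₀)).comp S (h := fun y => y - S₀)
        ((hasDerivAt_id S).sub_const S₀)).congr_deriv (mul_one _)
    have h2 : HasDerivAt (fun y : ℝ => max (S₀ - y - M * (t - t₀)) 0 ^ 2) (2 * max Y 0 * -1) S :=
      (hasDerivAt_max_zero_sq Y).comp S (h := fun y => S₀ - y - M * (t - t₀))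
        (((hasDerivAt_id S).const_sub S₀).sub_const (M * (t - t₀)))
    exact (hf.hasDerivAt_dualValue_budget hlam hK hτ S).sub ((h1.add h2).const_mul A)
  have hloc : ∀ᶠ y in 𝓝 S, u t S - φ S ≤ u t y - φ y := by
    filter_upwards [Icc_mem_nhds hSL hSR] with y hy
    have h := hmin (t, y) ⟨⟨ht1, ht2⟩, hy⟩
    simp only [hΦ] at h
    simp only [hφdef]
    linarith
  have hY0 : 0 ≤ max Y 0 := le_max_right _ _
  have hH : hamiltonian lam f (ξ - A * (2 * max (S - S₀) 0 + 2 * max Y 0 * -1)) <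
      hamiltonian lam f ξ + 2 * A * M * max Y 0 + e / 2 := by
    have h1 : 0 ≤ A * max (S - S₀) 0 := mul_nonneg hA0 (le_max_right _ _)
    have h2 := hf.monotone_hamiltonian hlam
      (show ξ - A * (2 * max (S - S₀) 0 + 2 * max Y 0 * -1) ≤ ξ + 2 * A * max Y 0 by linarith)
    have h3 := hf.hamiltonian_sub_le hlam
      (show ξ ≤ ξ + 2 * A * max Y 0 by have := mul_nonneg hA0 hY0; linarith)
    rw [add_sub_cancel_left, ← hM] at h3
    linarith
  have hev := hu.eventually_sub_le hf hlam ⟨ht₀.1.trans ht1, htT⟩ hφ hloc hH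
  have hsmall1 : ∀ᶠ h in 𝓝[>] (0 : ℝ), h < T - t :=
    (gt_mem_nhds (sub_pos.2 htT)).filter_mono nhdsWithin_le_nhds
  have hsmall2 : ∀ᶠ h in 𝓝[>] (0 : ℝ), A * M ^ 2 * h < e / 2 := by
    have hcont : ContinuousAt (fun h : ℝ => A * M ^ 2 * h) 0 := by fun_prop
    exact (hcont.eventually (gt_mem_nhds (by simpa using half_pos he0))).filter_mono
      nhdsWithin_le_nhds
  obtain ⟨h, h0, h1, h2, h3⟩ := ((eventually_mem_nhdsWithin (s := Ioi (0 : ℝ))).and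
    (hev.and (hsmall1.and hsmall2))).exists
  have h0' : 0 < h := h0
  have hm := hmin (t + h, S) ⟨⟨by linarith, by linarith⟩, hS1, hS2⟩
  simp only [hΦ] at hm
  have hv := hf.dualValue_subgradient hlam hK (show 0 ≤ T - (t + h) by linarith) (T - t) S S
  rw [← hξ] at hv
  have hsq : max (S₀ - S - M * (t + h - t₀)) 0 ^ 2 ≤
      max Y 0 ^ 2 - 2 * max Y 0 * (M * h) + (M * h) ^ 2 := by
    have hMh : 0 ≤ M * h := mul_nonneg hM0 h0'.le
    have hYh : S₀ - S - M * (t + h - t₀) = Y - M * h := by rw [hY]; ring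
    have hab : |max (Y - M * h) 0| ≤ |max Y 0 - M * h| := by
      rw [abs_of_nonneg (le_max_right _ _)]
      refine max_le ?_ (abs_nonneg _)
      exact (sub_le_sub_right (le_max_left _ _) _).trans (le_abs_self _)
    rw [hYh]
    calc max (Y - M * h) 0 ^ 2 ≤ (max Y 0 - M * h) ^ 2 := sq_le_sq.2 hab
      _ = _ := by ring
  have hsq' := mul_le_mul_of_nonneg_left hsq hA0
  have h3' := mul_lt_mul_of_pos_right h3 h0'
  nlinarith

theorem IsWeakSemiconcaveSolution.eq_valueFn (hu : IsWeakSemiconcaveSolution lam K T f u)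
    (hf : IsPriceDensity f) (hlam : 0 < lam) (hK : 0 < K) {t : ℝ} (ht : t ∈ Icc 0 T) (S : ℝ) :
    u t S = valueFn lam K T f t S := by
  rw [hf.valueFn_eq hlam hK ht.2]
  exact le_antisymm (hu.le_dualValue hf hlam hK ht S) (hu.dualValue_le hf hlam hK ht S)

end

/-! ### The value function and the optimal feedback -/

theorem theorem1 (lam K T : ℝ) (hlam : 0 < lam) (hK : 0 < K) (hT : 0 < T)
    (f : ℝ → ℝ) (hf : IsPriceDensity f) :
    -- the mean price to beat is finite
    IntegrableOn (fun p : ℝ => p * f p) (Ioi 0) ∧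
    -- the Hamiltonian: the supremum is finite, explicit, and differentiable in `x`
    (∀ x : ℝ, BddAbove (range fun b : ℝ≥0 => ∫ p in (0 : ℝ)..(b : ℝ), f p * (1 + x * p))) ∧
    (∀ x : ℝ, x < 0 → hamiltonian lam f x =
      -lam * x * ∫ p in (0 : ℝ)..(-1 / x), priceCDF f (ENNReal.ofReal p)) ∧
    (∀ x : ℝ, 0 ≤ x → hamiltonian lam f x = lam * (1 + x * meanPrice f)) ∧
    Differentiable ℝ (hamiltonian lam f) ∧
    -- the value function
    (∀ t ∈ Icc 0 T, ∀ S : ℝ,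
      IsLUB ((fun x : ℝ => S * x - (T - t) * hamiltonian lam f x - x ^ 2 / (4 * K)) '' Iic 0)
        (valueFn lam K T f t S)) ∧
    -- it is the unique weak semi-concave solution of the Hamilton-Jacobi equation
    IsWeakSemiconcaveSolution lam K T f (valueFn lam K T f) ∧
    (∀ v : ℝ → ℝ → ℝ, IsWeakSemiconcaveSolution lam K T f v →
      ∀ t ∈ Icc 0 T, ∀ S : ℝ, v t S = valueFn lam K T f t S) ∧
    -- the optimal control function
    (∃ β : ℝ → ℝ → ℝ≥0∞, IsOptimalControlFunction lam K T f β ∧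
      ∀ t ∈ Icc 0 T, ∀ S : ℝ,
        (lam * (T - t) * meanPrice f ≤ S → β t S = ⊤) ∧
        (S < lam * (T - t) * meanPrice f →
          ∃ x : ℝ, x < 0 ∧
            S = (T - t) * deriv (hamiltonian lam f) x + x / (2 * K) ∧
            (∀ y : ℝ, S = (T - t) * deriv (hamiltonian lam f) y + y / (2 * K) → y = x) ∧
            β t S = ENNReal.ofReal (-1 / x))) := by
  refine ⟨hf.integrableOn_id_mul, fun x => ⟨_, (hf.isLUB_bidGain x).1⟩,
    fun x hx => hf.hamiltonian_of_neg lam hx, fun x hx => hf.hamiltonian_of_nonneg lam hx,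
    fun x => (hf.hasDerivAt_hamiltonian hlam x).differentiableAt, fun t ht S => ?_,
    hf.isWeakSemiconcaveSolution_valueFn hlam hK,
    fun v hv t ht S => hv.eq_valueFn hf hlam hK ht S,
    fun t S => bidOf (costate lam K f (T - t) S), hf.isOptimalControlFunction hlam hK,
    fun t ht S => ?_⟩
  · rw [hf.valueFn_eq hlam hK ht.2]
    exact hf.isLUB_dualValue hlam hK (sub_nonneg.2 ht.2) S
  · have hτ : 0 ≤ T - t := sub_nonneg.2 ht.2
    have hspec := hf.costate_spec hlam hK hτ S
    refine ⟨fun hS => bidOf_of_nonneg ?_, fun hS => ?_⟩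
    · by_contra! hneg
      have h1 := mul_le_mul_of_nonneg_left (hf.spendRate_le hlam (costate lam K f (T - t) S)) hτ
      have h2 : costate lam K f (T - t) S / (2 * K) < 0 :=
        div_neg_of_neg_of_pos hneg (by positivity)
      linarith
    · have hneg : costate lam K f (T - t) S < 0 := by
        by_contra! hpos
        have h1 : 0 ≤ costate lam K f (T - t) S / (2 * K) := by positivity
        rw [IsPriceDensity.spendRate_of_nonneg lam f hpos] at hspec
        linarith
      have hderiv : ∀ x, deriv (hamiltonian lam f) x = spendRate lam f x := fun x =>
        (hf.hasDerivAt_hamiltonian hlam x).deriv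
      refine ⟨costate lam K f (T - t) S, hneg, ?_, fun y hy => ?_, bidOf_of_neg hneg⟩
      · rw [hderiv, hspec]
      · rw [hderiv] at hy
        exact hf.costate_unique hlam hK hτ hy.symm
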